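/- An \emph{indexed grammar with $k$ counters} ($k\ge 0$) consists of pairwise disjoint finite sets $V$ (nonterminals), $\Sigma$ (terminals) and $I$ (indices), a start nonterminal $S\in V$, and a finite set of productions, each of one of the forms $$A\to(\nu,c_1,\dots,c_k),\qquad A\to(Bf,c_1,\dots,c_k),\qquad Af\to(\nu,c_1,\dots,c_k),$$ where $A,B\in V$, $f\in I$, $\nu\in(V\cup\Sigma)^*$ and $c_1,\dots,c_k\in\mathbb{N}_0$. Sentential forms are tuples $(\mu,n_1,\dots,n_k)$ with $\mu\in(VI^*\cup\Sigma)^*$ and $n_i\in\mathbb{N}_0$. For $\alpha\in I^*$ and $\nu\in(V\cup\Sigma)^*$ let $\nu[\alpha]$ be obtained from $\nu$ by writing $\alpha$ after every occurrence of a nonterminal. A derivation step replaces one occurrence of a block in $\mu$ (a nonterminal together with all the indices that follow it) as follows: a production of the first form replaces $A\alpha$ by $\nu[\alpha]$, one of the second form replaces $A\alpha$ by $Bf\alpha$, and one of the third form replaces $Af\alpha$ by $\nu[\alpha]$ (for any $\alpha\in I^*$); in each case $c_i$ is added to $n_i$ for $1\le i\le k$. With $\Rightarrow_G^*$ the reflexive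 and transitive closure of this relation, the generated language is $$L(G)=\{u\in\Sigma^* \mid (S,0,\dots,0)\Rightarrow_G^*(u,n_1,\dots,n_k)\text{ for some } n_1=\cdots=n_k\}.$$ The grammar is \emph{linear} if the right side of every production contains at most one occurrence of a nonterminal. For $\Sigma=\{a_1,\dots,a_t\}$ the Parikh image of $L\subseteq\Sigma^*$ is $\psi(L)=\{(|w|_{a_1},\dots,|w|_{a_t})\mid w\in L\}\subseteq\mathbb{N}_0^t$, where $|w|_a$ is the number of occurrences of $a$ in $w$. A subset of $\mathbb{N}_0^t$ is \emph{linear} if it has the form $\{v_0+i_1v_1+\cdots+i_lv_l\mid i_1,\dots,i_l\in\mathbb{N}_0\}$ with a constant $v_0\in\mathbb{N}_0^t$ and periods $v_1,\dots,v_l\in\mathbb{N}_0^t$, and \emph{semilinear} if it is a finite union of linear sets. \textbf{Corollary.} The languages generated by linear indexed grammars with counters are effectively semilinear: for every linear indexed grammar $G$ with counters, $\psi(L(G))$ is semilinear, and there is an algorithm that, given any such $G$ (with any number of counters and any alphabets), computes the constant and the periods of each of finitely many linear sets whose union is $\psi(L(G))$. Moreover the following problems are decidable, where the input is a linear indexed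 grammar $G$ with counters (and, for membership, a word $w$ over its terminal alphabet): \begin{itemize} \item emptiness: is $L(G)=\emptyset$? \item membership: is $w\in L(G)$? \item infiniteness: is $L(G)$ infinite? \end{itemize} -/

import Mathlib

/-- The productions of an indexed grammar with `k` counters, with nonterminals `V`, terminals `T`
and indices `I`. The vector `c` holds the (nonnegative) increments of the `k` counters. -/
inductive CounterProduction (V T I : Type*) (k : ℕ) where
  /-- `A → (ν, c₁, …, c_k)` -/
  | plain (A : V) (ν : List (Symbol T V)) (c : Fin k → ℕ)
  /-- `A → (B f, c₁, …, c_k)` -/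
  | push (A B : V) (f : I) (c : Fin k → ℕ)
  /-- `A f → (ν, c₁, …, c_k)` -/
  | pop (A : V) (f : I) (ν : List (Symbol T V)) (c : Fin k → ℕ)

/-- An indexed grammar with `k` counters. The finite set of productions is given by a list. -/
structure CounterIndexedGrammar (V T I : Type*) (k : ℕ) where
  /-- The start nonterminal. -/
  start : V
  /-- The productions. -/
  productions : List (CounterProduction V T I k)

/-- The indexed part of a sentential form: a word over terminals `a` and
blocks `A α`, where `A` is a nonterminal and `α` is a word of indices. -/
abbrev SententialForm (V T I : Type*) := List (Symbol T (V × List I))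

/-- Distribute the index word `α` over all nonterminals of `ν`. -/
def attachIndices {V T I : Type*} (α : List I) (ν : List (Symbol T V)) : SententialForm V T I :=
  ν.map fun s => match s with
    | Symbol.terminal a => Symbol.terminal a
    | Symbol.nonterminal A => Symbol.nonterminal (A, α)

/-- The number of occurrences of nonterminals in a word over nonterminals and terminals. -/
def countNonterminals {V T : Type*} (ν : List (Symbol T V)) : ℕ :=
  ν.countP fun s => match s with
    | Symbol.terminal _ => false
    | Symbol.nonterminal _ => true

namespace CounterProduction

variable {V T I : Type*} {k : ℕ}

/-- The counter increments of a production. -/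
def increments : CounterProduction V T I k → (Fin k → ℕ)
  | plain _ _ c => c
  | push _ _ _ c => c
  | pop _ _ _ c => c

/-- The number of nonterminal occurrences on the right side of a production. -/
def rhsNonterminals : CounterProduction V T I k → ℕ
  | plain _ ν _ => countNonterminals ν
  | push _ _ _ _ => 1
  | pop _ _ ν _ => countNonterminals ν

/-- `p.Rewrites A α μ`: applying `p` to the block `A α` replaces this block by `μ`. -/
inductive Rewrites : CounterProduction V T I k → V → List I → SententialForm V T I → Prop
  | plain (A : V) (ν : List (Symbol T V)) (c : Fin k → ℕ) (α : List I) :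
      Rewrites (.plain A ν c) A α (attachIndices α ν)
  | push (A B : V) (f : I) (c : Fin k → ℕ) (α : List I) :
      Rewrites (.push A B f c) A α [Symbol.nonterminal (B, f :: α)]
  | pop (A : V) (f : I) (ν : List (Symbol T V)) (c : Fin k → ℕ) (α : List I) :
      Rewrites (.pop A f ν c) A (f :: α) (attachIndices α ν)

end CounterProduction

namespace CounterIndexedGrammar

variable {V T I : Type*} {k : ℕ}

/-- One derivation step on pairs of a sentential form and the vector of counter values. -/
inductive Step (G : CounterIndexedGrammar V T I k) :
    SententialForm V T I × (Fin k → ℕ) → SententialForm V T I × (Fin k → ℕ) → Prop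
  | mk (p : CounterProduction V T I k) (hp : p ∈ G.productions) (A : V) (α : List I)
      (μ : SententialForm V T I) (h : p.Rewrites A α μ)
      (x y : SententialForm V T I) (n : Fin k → ℕ) :
      Step G (x ++ [Symbol.nonterminal (A, α)] ++ y, n) (x ++ μ ++ y, n + p.increments)

/-- The reflexive and transitive closure of the step relation. -/
def Derives (G : CounterIndexedGrammar V T I k) :
    SententialForm V T I × (Fin k → ℕ) → SententialForm V T I × (Fin k → ℕ) → Prop :=
  Relation.ReflTransGen G.Step

/-- The generated language: the terminal words derivable from the start nonterminal (with empty
index word and all counters zero) in such a way that all counters end up with equal values. -/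
def language (G : CounterIndexedGrammar V T I k) : Language T :=
  {u | ∃ n : Fin k → ℕ,
    G.Derives ([Symbol.nonterminal (G.start, [])], 0) (u.map Symbol.terminal, n) ∧
      ∀ i j, n i = n j}

/-- The grammar is linear: the right side of every production has at most one nonterminal
occurrence. -/
def IsLinear (G : CounterIndexedGrammar V T I k) : Prop :=
  ∀ p ∈ G.productions, p.rhsNonterminals ≤ 1

end CounterIndexedGrammar

/-- The Parikh image `ψ(L) ⊆ ℕ^t` of a language over a terminal alphabet with `t` letters,
listed in the order given by `e`. -/
def parikhImage {T : Type*} {t : ℕ} (e : T ≃ Fin t) (L : Language T) : Set (Fin t → ℕ) :=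
  {x | ∃ w ∈ L, x = fun i => (w.map e).count i}

/-- A finite representation of a semilinear subset of `ℕ^t`: a list of pairs, each consisting of a
constant and a list of periods. -/
abbrev SemilinearRep (t : ℕ) := List ((Fin t → ℕ) × List (Fin t → ℕ))

/-- The represented semilinear set: the union of the linear sets
`{v₀ + i₁ v₁ + ⋯ + i_l v_l | i₁, …, i_l ∈ ℕ}`. -/
def SemilinearRep.toSet {t : ℕ} (S : SemilinearRep t) : Set (Fin t → ℕ) :=
  {x | ∃ p ∈ S, ∃ c : Fin p.2.length → ℕ, x = p.1 + ∑ j, c j • p.2.get j}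

/-! Finite data read and written by algorithms. -/

/-- Codes of semilinear representations: vectors are lists of numbers. -/
abbrev SemilinearCode := List (List ℕ × List (List ℕ))

/-- The code of a semilinear representation. -/
def SemilinearRep.code {t : ℕ} (S : SemilinearRep t) : SemilinearCode :=
  List.map (fun p => (List.ofFn p.1, p.2.map List.ofFn)) S

/-- Codes of productions. In words on right sides, `Sum.inl` marks terminals
and `Sum.inr` marks nonterminals. -/
abbrev ProductionCode :=
  (ℕ × List (ℕ ⊕ ℕ) × List ℕ) ⊕ (ℕ × ℕ × ℕ × List ℕ) ⊕ (ℕ × ℕ × List (ℕ ⊕ ℕ) × List ℕ)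

/-- Codes of indexed grammars with counters: the numbers of nonterminals, terminals, indices and
counters; the start nonterminal; the list of productions. -/
abbrev GrammarCode := (ℕ × ℕ × ℕ × ℕ) × ℕ × List ProductionCode

section Codes

variable {V T I : Type*} {k v t m : ℕ}

/-- The code of a word over nonterminals and terminals, for given numberings of these. -/
def codeRhs (eV : V ≃ Fin v) (eT : T ≃ Fin t) (ν : List (Symbol T V)) : List (ℕ ⊕ ℕ) :=
  ν.map fun s => match s with
    | Symbol.terminal a => Sum.inl (eT a : ℕ)
    | Symbol.nonterminal A => Sum.inr (eV A : ℕ)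

/-- The code of a production, for given numberings of the symbols. -/
def CounterProduction.code (eV : V ≃ Fin v) (eT : T ≃ Fin t) (eI : I ≃ Fin m) :
    CounterProduction V T I k → ProductionCode
  | .plain A ν c => Sum.inl ((eV A : ℕ), codeRhs eV eT ν, List.ofFn c)
  | .push A B f c => Sum.inr (Sum.inl ((eV A : ℕ), (eV B : ℕ), (eI f : ℕ), List.ofFn c))
  | .pop A f ν c => Sum.inr (Sum.inr ((eV A : ℕ), (eI f : ℕ), codeRhs eV eT ν, List.ofFn c))

/-- The code of a grammar, for given numberings of the symbols. -/
def CounterIndexedGrammar.code (eV : V ≃ Fin v) (eT : T ≃ Fin t) (eI : I ≃ Fin m)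
    (G : CounterIndexedGrammar V T I k) : GrammarCode :=
  ((v, t, m, k), (eV G.start : ℕ), G.productions.map (CounterProduction.code eV eT eI))

/-- The code of a terminal word, for a given numbering of the terminals. -/
def codeWord (eT : T ≃ Fin t) (w : List T) : List ℕ :=
  w.map fun a => (eT a : ℕ)

end Codes

/-! A sentential form of a linear grammar contains at most one block `A α`, so a derivation is a run
of a pushdown system with state `A` and stack `α`. For Parikh images the side on which terminals are
written does not matter: a run just outputs a multiset of letters, namely the terminals and one
symbol per unit of each counter. Once the nonterminal is gone the system empties its stack, so
derivations of terminal words become runs that end with the empty stack (`Generates.run`,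
`IsLinear.generates_of_run`).

Cutting runs at matching pushes and pops gives a context-free grammar with nonterminals `(p, q)`
(`run_iff_matched`). Its outputs are described as in Parikh's theorem: a multiset of rules is used
by some derivation iff every nonterminal is consumed as often as it is supplied and all rules are
reachable from the start (`Der.balance`, `exists_connected_of_der`, `der_of_balance_of_reach`). Each
choice of a connected set of rules gives a linear set, with every chosen rule used once in the
constant and again as a period; the balance conditions are equations between numbers of letters.

Such an equation cuts a semilinear set down to a semilinear one, with explicit bounds on the new
constants and periods (`semiSet_restrictEq`, by way of `exists_decomposition`). The same lemma
serves twice: for the balance of nonterminals and for the equality of the counters. Deleting all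
letters but the terminals yields the Parikh image.

All these constructions are primitive recursive functions on lists. Emptiness and infiniteness are
read off the representation: a linear set is never empty, and it is infinite iff it has a nonzero
period. Membership is not determined by the Parikh image; there each state also carries the word
still to be generated, which leaves only derivations of the given word, and the question becomes one
of emptiness. -/

/-! ### Semilinear sets of multisets and their restriction by linear equations. -/

namespace SemilinearWords

variable {α β : Type*}

/-- All words of length at most `n` over the letters of `l`. -/
def words (l : List β) : ℕ → List (List β)
  | 0 => [[]]
  | n + 1 => [] :: (words l n).flatMap fun w => l.map fun x => x :: w

theorem mem_words {l : List β} {n : ℕ} {w : List β} :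
    w ∈ words l n ↔ w.length ≤ n ∧ ∀ x ∈ w, x ∈ l := by
  induction n generalizing w with
  | zero => simp +contextual [words]
  | succ n ih =>
    cases w with
    | nil => simp [words]
    | cons x w =>
      simp only [words, List.mem_cons, reduceCtorEq, List.mem_flatMap, List.mem_map,
        List.cons.injEq, false_or, List.length_cons, forall_eq_or_imp, add_le_add_iff_right]
      constructor
      · rintro ⟨w', hw', x', hx', rfl, rfl⟩
        exact ⟨(ih.1 hw').1, hx', (ih.1 hw').2⟩
      · rintro ⟨h1, h2, h3⟩
        exact ⟨w, ih.2 ⟨h1, h3⟩, x, h2, rfl, rfl⟩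

/-! ### Decomposition of solutions of a linear equation -/

/-- A finite family of integers can be ordered so that all partial sums stay bounded. -/
theorem exists_perm_prefix_sums_bounded (f : β → ℤ) (C : ℤ) (w : List β)
    (hw : ∀ x ∈ w, |f x| ≤ C) (b : ℤ) (hb : |b| ≤ C) (h : b + (w.map f).sum = 0) :
    ∃ l : List β, l.Perm w ∧ ∀ k, |b + ((l.take k).map f).sum| ≤ C := by
  induction hn : w.length generalizing w b with
  | zero =>
    obtain rfl := List.length_eq_zero_iff.1 hn
    exact ⟨[], .refl _, by simpa using hb⟩
  | succ n ih =>
    -- Greedy choice: a letter whose value has sign opposite to `b` keeps the sum within `[-C, C]`.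
    -- If no letter works, all values push `b` away from zero and the total cannot vanish.
    have key : ∃ x ∈ w, |b + f x| ≤ C := by
      by_contra! hcon
      have hne : w ≠ [] := by rintro rfl; simp at hn
      obtain ⟨y, hy⟩ := List.exists_mem_of_ne_nil w hne
      rcases lt_or_ge 0 b with hb0 | hb0
      · have : ∀ x ∈ w, 0 ≤ f x := by
          intro x hx
          by_contra! hlt
          have h1 := hcon x hx
          have h2 := abs_le.1 (hw x hx)
          have h3 := abs_le.1 hb
          exact absurd (abs_le.2 ⟨by linarith, by linarith⟩) (not_le.2 h1)
        have := List.sum_nonneg (l := w.map f) (by simpa using this)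
        linarith
      · have : ∀ x ∈ w, f x < 0 := by
          intro x hx
          by_contra! hlt
          have h1 := hcon x hx
          have h2 := abs_le.1 (hw x hx)
          have h3 := abs_le.1 hb
          exact absurd (abs_le.2 ⟨by linarith, by linarith⟩) (not_le.2 h1)
        have h4 : (w.map f).sum < (w.map fun _ => (0 : ℤ)).sum :=
          List.sum_lt_sum_of_ne_nil hne _ _ this
        simp at h4
        linarith
    obtain ⟨x, hx, hxC⟩ := key
    obtain ⟨s, t, rfl⟩ := List.append_of_mem hx
    obtain ⟨l, hl, hlC⟩ := ih (s ++ t) (fun y hy => hw y (by simp at hy ⊢; tauto)) (b + f x) hxC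
      (by simp at h ⊢; linarith) (by simp at hn ⊢; omega)
    refine ⟨x :: l, (hl.cons x).trans List.perm_middle.symm, fun k => ?_⟩
    cases k with
    | zero => simpa using hb
    | succ k => simpa [add_assoc] using hlC k

/-- Every solution of a linear equation is the sum of a short solution and of short solutions of
the homogeneous equation. -/
theorem exists_decomposition (f : β → ℤ) (C : ℕ) (b : ℤ) (hb : |b| ≤ C) (w : List β)
    (hw : ∀ x ∈ w, |f x| ≤ C) (h : b + (w.map f).sum = 0) :
    ∃ (w₀ : List β) (ws : List (List β)), w.Perm (w₀ ++ ws.flatten) ∧ w₀.length ≤ 2 * C + 1 ∧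
      b + (w₀.map f).sum = 0 ∧ ∀ u ∈ ws, u.length ≤ 2 * C + 1 ∧ (u.map f).sum = 0 := by
  induction hn : w.length using Nat.strong_induction_on generalizing w with
  | _ n ih =>
  rcases Nat.lt_or_ge (2 * C + 1) n with hlt | hle
  swap
  · exact ⟨w, [], by simp, by omega, h, by simp⟩
  obtain ⟨l, hl, hlC⟩ := exists_perm_prefix_sums_bounded f C w hw b hb h
  have hlen : l.length = n := by rw [hl.length_eq, hn]
  -- Pigeonhole: the `2 * C + 2` prefixes of length at most `2 * C + 1` have sums among `2 * C + 1`
  -- integers. The letters between two prefixes with equal sums form a short homogeneous solution,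
  -- which is cut out before recursing.
  obtain ⟨i, hi, j, hj, hij, heq⟩ := Finset.exists_ne_map_eq_of_card_lt_of_maps_to
    (s := Finset.range (2 * C + 2)) (t := Finset.Icc (-(C : ℤ)) C)
    (f := fun k => b + ((l.take k).map f).sum) (by simp; omega)
    (fun k _ => by simpa using abs_le.1 (hlC k))
  wlog hlt' : i < j generalizing i j
  · exact this j hj i hi hij.symm heq.symm (by omega)
  simp only [Finset.mem_range] at hi hj
  have hsplit : l = l.take i ++ ((l.drop i).take (j - i) ++ l.drop j) := by
    conv_lhs => rw [← List.take_append_drop i l, ← List.take_append_drop (j - i) (l.drop i)]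
    rw [List.drop_drop]; congr 4; omega
  have htake : l.take j = l.take i ++ (l.drop i).take (j - i) := by
    conv_lhs => rw [show j = i + (j - i) by omega, List.take_add]
  have hmid : (((l.drop i).take (j - i)).map f).sum = 0 := by
    simp only [htake, List.map_append, List.sum_append] at heq
    linarith
  have hperm : w.Perm ((l.take i ++ l.drop j) ++ (l.drop i).take (j - i)) := by
    refine hl.symm.trans ?_
    conv_lhs => rw [hsplit]
    rw [List.append_assoc]
    exact List.Perm.append_left _ List.perm_append_comm
  have hsum : b + ((l.take i ++ l.drop j).map f).sum = 0 := by
    have := (hperm.map f).sum_eq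
    rw [List.map_append, List.sum_append, hmid, add_zero] at this
    rw [← this, h]
  have hmem : ∀ x ∈ l.take i ++ l.drop j, |f x| ≤ C := fun x hx =>
    hw x (hperm.mem_iff.2 (List.mem_append_left _ hx))
  obtain ⟨w₀, ws, h1, h2, h3, h4⟩ := ih _ (by simp; omega) _ hmem hsum rfl
  refine ⟨w₀, (l.drop i).take (j - i) :: ws, ?_, h2, h3, ?_⟩
  · refine hperm.trans ((h1.append_right _).trans ?_)
    rw [List.append_assoc, List.flatten_cons]
    exact List.Perm.append_left _ List.perm_append_comm
  · simp only [List.mem_cons, forall_eq_or_imp]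
    exact ⟨⟨by simp; omega, hmid⟩, h4⟩

/-! ### Semilinear sets of multisets, represented by words -/

/-- A linear set of multisets: a constant and a list of periods, all given by words. -/
abbrev LinRep (α : Type*) := List α × List (List α)

/-- The set represented by `p`. -/
def linSet (p : LinRep α) : Set (Multiset α) :=
  {x | ∃ w : List (List α), (∀ u ∈ w, u ∈ p.2) ∧ x = ↑(p.1 ++ w.flatten)}

/-- The union of the linear sets represented by the members of `S`. -/
def semiSet (S : List (LinRep α)) : Set (Multiset α) :=
  {x | ∃ p ∈ S, x ∈ linSet p}

section Restrict

variable [DecidableEq α]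

/-- Both letters of `e` occur equally often in `w`. -/
def balanced (e : α × α) (w : List α) : Bool := w.count e.1 == w.count e.2

/-- A bound for the lengths of indecomposable solutions. -/
def lengthBound (p : LinRep α) : ℕ := 2 * (p.1 ++ p.2.flatten).length + 1

/-- Sums of few periods in which both letters of `e` occur equally often. -/
def balancedPeriods (e : α × α) (p : LinRep α) : List (List α) :=
  (words p.2 (lengthBound p)).flatMap fun w => bif balanced e w.flatten then [w.flatten] else []

/-- The members of a linear set in which both letters of `e` occur equally often. -/
def restrictEq (e : α × α) (p : LinRep α) : List (LinRep α) :=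
  (words p.2 (lengthBound p)).flatMap fun w =>
    bif balanced e (p.1 ++ w.flatten) then [(p.1 ++ w.flatten, balancedPeriods e p)] else []

/-- Restriction by a list of equations. -/
def restrictEqs (es : List (α × α)) (S : List (LinRep α)) : List (LinRep α) :=
  es.foldl (fun S e => S.flatMap (restrictEq e)) S

theorem balanced_iff {e : α × α} {w : List α} :
    balanced e w = true ↔ w.count e.1 = w.count e.2 := by
  simp [balanced]

theorem mem_balancedPeriods {e : α × α} {p : LinRep α} {v : List α} :
    v ∈ balancedPeriods e p ↔ ∃ w : List (List α), w.length ≤ lengthBound p ∧ (∀ u ∈ w, u ∈ p.2) ∧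
      w.flatten = v ∧ v.count e.1 = v.count e.2 := by
  simp only [balancedPeriods, List.mem_flatMap, mem_words, Bool.cond_eq_ite, balanced_iff]
  constructor
  · rintro ⟨w, ⟨h1, h2⟩, h3⟩
    split_ifs at h3 with hb
    · obtain rfl := List.mem_singleton.1 h3
      exact ⟨w, h1, h2, rfl, hb⟩
    · simp at h3
  · rintro ⟨w, h1, h2, rfl, hb⟩
    exact ⟨w, ⟨h1, h2⟩, by simp [hb]⟩

theorem mem_restrictEq {e : α × α} {p q : LinRep α} :
    q ∈ restrictEq e p ↔ ∃ w : List (List α), w.length ≤ lengthBound p ∧ (∀ u ∈ w, u ∈ p.2) ∧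
      (p.1 ++ w.flatten).count e.1 = (p.1 ++ w.flatten).count e.2 ∧
      q = (p.1 ++ w.flatten, balancedPeriods e p) := by
  simp only [restrictEq, List.mem_flatMap, mem_words, Bool.cond_eq_ite, balanced_iff]
  constructor
  · rintro ⟨w, ⟨h1, h2⟩, h3⟩
    split_ifs at h3 with hb
    · exact ⟨w, h1, h2, hb, List.mem_singleton.1 h3⟩
    · simp at h3
  · rintro ⟨w, h1, h2, hb, rfl⟩
    exact ⟨w, ⟨h1, h2⟩, by simp [hb]⟩

theorem count_flatten_eq_of_forall {a b : α} {ws : List (List α)}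
    (h : ∀ u ∈ ws, u.count a = u.count b) : ws.flatten.count a = ws.flatten.count b := by
  rw [List.count_flatten, List.count_flatten, List.map_congr_left h]

/-- The difference of the numbers of occurrences of the letters of `e`. -/
def excess (e : α × α) (w : List α) : ℤ := (w.count e.1 : ℤ) - w.count e.2

theorem excess_append (e : α × α) (v w : List α) : excess e (v ++ w) = excess e v + excess e w := by
  simp [excess]; ring

theorem excess_flatten (e : α × α) (ws : List (List α)) :
    excess e ws.flatten = (ws.map (excess e)).sum := by
  induction ws with
  | nil => simp [excess]
  | cons w ws ih => simp [excess_append, ih]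

theorem abs_excess_le (e : α × α) (w : List α) : |excess e w| ≤ w.length := by
  have h1 := List.count_le_length (a := e.1) (l := w)
  have h2 := List.count_le_length (a := e.2) (l := w)
  rw [excess, abs_le]
  constructor <;> omega

theorem excess_eq_zero {e : α × α} {w : List α} : excess e w = 0 ↔ w.count e.1 = w.count e.2 := by
  rw [excess]; omega

/-- The excess is additive, so the condition is one linear equation in the chosen periods, with the
excess of `p.1` as inhomogeneous term. `exists_decomposition` splits the chosen periods into a short
particular solution, which goes into the new constant, and short homogeneous solutions, which are
the new periods. -/
theorem semiSet_restrictEq (e : α × α) (p : LinRep α) :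
    semiSet (restrictEq e p) = {x | x ∈ linSet p ∧ x.count e.1 = x.count e.2} := by
  ext x
  constructor
  · rintro ⟨q, hq, w, hw, rfl⟩
    obtain ⟨w₀, -, h2, h3, rfl⟩ := mem_restrictEq.1 hq
    -- `g u` lists the old periods whose concatenation is the new period `u`.
    choose! g hg using fun u hu => mem_balancedPeriods.1 (hw u hu)
    refine ⟨⟨w₀ ++ (w.map g).flatten, ?_, ?_⟩, ?_⟩
    · simp only [List.mem_append, List.mem_flatten, List.mem_map]
      rintro u (hu | ⟨_, ⟨v, hv, rfl⟩, huv⟩)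
      · exact h2 u hu
      · exact (hg v hv).2.1 u huv
    · have : (w.map g).flatten.flatten = w.flatten := by
        rw [List.flatten_flatten, List.map_map]
        congr 1
        conv_rhs => rw [← List.map_id w]
        exact List.map_congr_left fun v hv => (hg v hv).2.2.1
      simp [this]
    · simp only [Multiset.coe_count, List.count_append] at h3 ⊢
      rw [h3, count_flatten_eq_of_forall fun u hu => (hg u hu).2.2.2]
  · rintro ⟨⟨w, hw, rfl⟩, hx⟩
    -- The total length of the constant and all periods bounds the excess of each of them;
    -- `lengthBound p` is `2 * C + 1`.
    set C := (p.1 ++ p.2.flatten).length with hC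
    have hbound : ∀ u ∈ p.2, u.length ≤ p.2.flatten.length := fun u hu =>
      (List.sublist_flatten_of_mem hu).length_le
    have hsum : excess e p.1 + (w.map (excess e)).sum = 0 := by
      rw [← excess_flatten, ← excess_append, excess_eq_zero]
      simpa using hx
    obtain ⟨w₀, ws, h1, h2, h3, h4⟩ := exists_decomposition (excess e) C (excess e p.1)
      ((abs_excess_le e _).trans (by rw [hC, List.length_append]; omega)) w
      (fun u hu => (abs_excess_le e _).trans (by
        have := hbound u (hw u hu)
        rw [hC, List.length_append]; omega)) hsum
    have hmem : ∀ u ∈ w₀ ++ ws.flatten, u ∈ p.2 := fun u hu => hw u (h1.mem_iff.2 hu)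
    refine ⟨_, mem_restrictEq.2 ⟨w₀, h2, fun u hu => hmem u (List.mem_append_left _ hu), ?_, rfl⟩,
      ws.map List.flatten, ?_, ?_⟩
    · rw [← excess_eq_zero, excess_append, excess_flatten, h3]
    · simp only [List.mem_map, forall_exists_index, and_imp, forall_apply_eq_imp_iff₂]
      intro u hu
      refine mem_balancedPeriods.2 ⟨u, (h4 u hu).1, fun v hv => hmem v
        (List.mem_append_right _ (List.mem_flatten.2 ⟨u, hu, hv⟩)), rfl, ?_⟩
      rw [← excess_eq_zero, excess_flatten, (h4 u hu).2]
    · rw [Multiset.coe_eq_coe, List.append_assoc, ← List.flatten_flatten, ← List.flatten_append]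
      exact List.Perm.append_left _ h1.flatten

theorem semiSet_restrictEqs (es : List (α × α)) (S : List (LinRep α)) :
    semiSet (restrictEqs es S) = {x | x ∈ semiSet S ∧ ∀ e ∈ es, x.count e.1 = x.count e.2} := by
  induction es generalizing S with
  | nil => simp [restrictEqs]
  | cons e es ih =>
    rw [restrictEqs, List.foldl_cons, ← restrictEqs, ih]
    ext x
    have : x ∈ semiSet (S.flatMap (restrictEq e)) ↔ x ∈ semiSet S ∧ x.count e.1 = x.count e.2 := by
      have h := fun p => Set.ext_iff.1 (semiSet_restrictEq e p) x
      simp only [semiSet, Set.mem_ofPred_eq, List.mem_flatMap] at h ⊢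
      constructor
      · rintro ⟨q, ⟨p, hp, hq⟩, hx⟩
        have := (h p).1 ⟨q, hq, hx⟩
        exact ⟨⟨p, hp, this.1⟩, this.2⟩
      · rintro ⟨⟨p, hp, hx⟩, hc⟩
        obtain ⟨q, hq, hx⟩ := (h p).2 ⟨hx, hc⟩
        exact ⟨q, ⟨p, hp, hq⟩, hx⟩
    simp only [Set.mem_ofPred_eq, this, List.mem_cons, forall_eq_or_imp, and_assoc]

end Restrict

/-- Delete or rename letters. -/
def project (f : α → Option β) (p : LinRep α) : LinRep β :=
  (p.1.filterMap f, p.2.map (List.filterMap f))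

theorem mem_semiSet_project (f : α → Option β) (S : List (LinRep α)) (y : Multiset β) :
    y ∈ semiSet (S.map (project f)) ↔ ∃ x ∈ semiSet S, y = x.filterMap f := by
  simp only [semiSet, linSet, Set.mem_ofPred_eq, List.mem_map]
  constructor
  · rintro ⟨_, ⟨p, hp, rfl⟩, w, hw, rfl⟩
    simp only [project, List.mem_map] at hw
    choose! g hg using hw
    refine ⟨_, ⟨p, hp, w.map g, ?_, rfl⟩, ?_⟩
    · simpa using fun u hu => (hg u hu).1
    · have : (w.map g).flatten.filterMap f = w.flatten := by
        rw [List.filterMap_flatten, List.map_map]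
        congr 1
        conv_rhs => rw [← List.map_id w]
        exact List.map_congr_left fun u hu => (hg u hu).2
      simp [project, this]
  · rintro ⟨_, ⟨p, hp, w, hw, rfl⟩, rfl⟩
    refine ⟨_, ⟨p, hp, rfl⟩, w.map (List.filterMap f), ?_, ?_⟩
    · simp only [List.mem_map, project, forall_exists_index, and_imp, forall_apply_eq_imp_iff₂]
      exact fun u hu => ⟨u, hw u hu, rfl⟩
    · simp [project, List.filterMap_flatten]

end SemilinearWords

/-! ### Parikh's theorem for commutative context-free grammars. -/

namespace CommutativeGrammar

open SemilinearWords

variable {N α : Type*}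

theorem exists_map_eq_of_forall {β γ : Type*} {f : β → γ} {P : β → Prop} {w : List γ}
    (h : ∀ u ∈ w, ∃ a, P a ∧ f a = u) : ∃ w' : List β, (∀ a ∈ w', P a) ∧ w'.map f = w := by
  induction w with
  | nil => exact ⟨[], by simp, rfl⟩
  | cons u w ih =>
    obtain ⟨a, ha, rfl⟩ := h u (by simp)
    obtain ⟨w', hw', rfl⟩ := ih fun v hv => h v (List.mem_cons_of_mem _ hv)
    exact ⟨a :: w', by simpa using ⟨ha, hw'⟩, rfl⟩

/-- A rule `X → v Y₁ ⋯ Yₘ` of a commutative grammar. -/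
abbrev Rule (N α : Type*) := N × List α × List N

/-- `Der M y`: the multiset `M` of nonterminals can be eliminated by a derivation which uses
exactly the multiset `y` of rules. -/
inductive Der : Multiset N → Multiset (Rule N α) → Prop
  | nil : Der 0 0
  | cons (r : Rule N α) (M : Multiset N) (y : Multiset (Rule N α)) :
      Der (↑r.2.2 + M) y → Der (r.1 ::ₘ M) (r ::ₘ y)

/-- The nonterminals consumed by the rules of `y`. -/
def lhs (y : Multiset (Rule N α)) : Multiset N := y.map fun r => r.1

/-- The nonterminals produced by the rules of `y`. -/
def rhs (y : Multiset (Rule N α)) : Multiset N := (y.map fun r => (r.2.2 : Multiset N)).sum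

/-- The letters produced by the rules of `y`. -/
def output (y : Multiset (Rule N α)) : Multiset α := (y.map fun r => (r.2.1 : Multiset α)).sum

theorem mem_rhs {Z : N} {y : Multiset (Rule N α)} : Z ∈ rhs y ↔ ∃ s ∈ y, Z ∈ s.2.2 := by
  induction y using Multiset.induction_on with
  | empty => simp [rhs]
  | cons r y ih =>
    rw [rhs, Multiset.map_cons, Multiset.sum_cons, ← rhs, Multiset.mem_add, ih]
    simp

@[simp] theorem output_cons (r : Rule N α) (y : Multiset (Rule N α)) :
    output (r ::ₘ y) = ↑r.2.1 + output y := by simp [output]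

@[simp] theorem output_zero : output (0 : Multiset (Rule N α)) = 0 := by simp [output]

@[simp] theorem output_add (y z : Multiset (Rule N α)) : output (y + z) = output y + output z := by
  simp [output]

theorem Der.add {M M' : Multiset N} {y y' : Multiset (Rule N α)} (h : Der M y) (h' : Der M' y') :
    Der (M + M') (y + y') := by
  induction h with
  | nil => simpa using h'
  | cons r M y _ ih =>
    rw [Multiset.cons_add, Multiset.cons_add]
    exact .cons r _ _ (by rwa [← add_assoc])

/-- The first of two necessary conditions on the rules of a derivation; together with reachability
it is also sufficient, by `der_of_balance_of_reach`. -/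
theorem Der.balance {M : Multiset N} {y : Multiset (Rule N α)} (h : Der M y) :
    M + rhs y = lhs y := by
  induction h with
  | nil => simp [rhs, lhs]
  | cons r M y _ ih =>
    rw [lhs, Multiset.map_cons, ← lhs, ← ih, rhs, Multiset.map_cons, Multiset.sum_cons, ← rhs,
      Multiset.cons_add]
    congr 1
    abel

/-- The nonterminals reachable from `M` by the rules of `y`. -/
inductive Reach (M : Multiset N) (y : Multiset (Rule N α)) : N → Prop
  | base (Z : N) : Z ∈ M → Reach M y Z
  | step (r : Rule N α) (Z : N) : r ∈ y → Reach M y r.1 → Z ∈ r.2.2 → Reach M y Z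

theorem Reach.mono {M M' : Multiset N} {y y' : Multiset (Rule N α)} {Z : N} (h : Reach M y Z)
    (hM : M ⊆ M') (hy : y ⊆ y') : Reach M' y' Z := by
  induction h with
  | base Z hZ => exact .base Z (hM hZ)
  | step r Z hr _ hZ ih => exact .step r Z (hy hr) ih hZ

/-- A rule which can be applied to `Z` without losing connectivity. -/
theorem exists_rule_keeping_reach {Z : N} {M : Multiset N} {y : Multiset (Rule N α)}
    (hb : Z ::ₘ M + rhs y = lhs y) (hr : ∀ r ∈ y, Reach (Z ::ₘ M) y r.1) :
    ∃ (r : Rule N α) (y' : Multiset (Rule N α)), y = r ::ₘ y' ∧ r.1 = Z ∧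
      ∀ s ∈ y', Reach ((r.2.2 : Multiset N) + M) y' s.1 := by
  classical
  obtain ⟨r₀, hr₀, hr₀Z⟩ : ∃ r ∈ y, r.1 = Z := by
    have : Z ∈ lhs y := by rw [← hb]; simp
    simpa [lhs] using this
  -- The rules that do not expand `Z`. They survive whichever rule for `Z` is applied.
  set y₁ := y.filter fun r => r.1 ≠ Z with hy₁
  have hsub : ∀ {r : Rule N α} {y'}, y = r ::ₘ y' → r.1 = Z → y₁ ⊆ y' := by
    rintro r y' rfl hrZ s hs
    rw [hy₁, Multiset.mem_filter, Multiset.mem_cons] at hs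
    rcases hs with ⟨rfl | hs, h⟩
    · exact absurd hrZ h
    · exact hs
  -- If `Z` can be regained after `r` without expanding `Z`, then applying `r` loses nothing:
  -- whatever was reached through `Z` is still reached, and the right side of `r` is now available.
  by_cases hret : ∃ r ∈ y, r.1 = Z ∧ Reach ((r.2.2 : Multiset N) + M) y₁ Z
  · obtain ⟨r, hry, hrZ, hreach⟩ := hret
    obtain ⟨y', hy'⟩ := Multiset.exists_cons_of_mem hry
    refine ⟨r, y', hy', hrZ, fun s hs => ?_⟩
    have key : ∀ V, Reach (Z ::ₘ M) y V → Reach ((r.2.2 : Multiset N) + M) y' V := by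
      intro V hV
      induction hV with
      | base V hV =>
        rcases Multiset.mem_cons.1 hV with rfl | hV
        · exact hreach.mono (fun _ h => h) (hsub hy' hrZ)
        · exact .base V (Multiset.mem_add.2 (Or.inr hV))
      | step s V hs _ hV ih =>
        rw [hy', Multiset.mem_cons] at hs
        rcases hs with rfl | hs
        · exact .base V (Multiset.mem_add.2 (Or.inl hV))
        · exact .step s V hs ih hV
    exact key _ (hr s (by rw [hy']; exact Multiset.mem_cons_of_mem hs))
  -- If no rule leads back to `Z`, then `Z` occurs neither in `M` nor on a right side in `y`. By
  -- balance `r₀` is the only rule for `Z`, so no remaining rule needs `Z` again.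
  · push Not at hret
    have key : ∀ V, Reach (Z ::ₘ M) y V →
        V = Z ∨ ∃ r ∈ y, r.1 = Z ∧ Reach ((r.2.2 : Multiset N) + M) y₁ V := by
      intro V hV
      induction hV with
      | base V hV =>
        rcases Multiset.mem_cons.1 hV with rfl | hV
        · exact Or.inl rfl
        · exact Or.inr ⟨r₀, hr₀, hr₀Z, .base V (Multiset.mem_add.2 (Or.inr hV))⟩
      | step s V hs _ hV ih =>
        by_cases hsZ : s.1 = Z
        · exact Or.inr ⟨s, hs, hsZ, .base V (Multiset.mem_add.2 (Or.inl hV))⟩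
        · rcases ih with h | ⟨r, hry, hrZ, h⟩
          · exact absurd h hsZ
          · exact Or.inr ⟨r, hry, hrZ, .step s V (Multiset.mem_filter.2 ⟨hs, hsZ⟩) h hV⟩
    have hZrhs : Z ∉ rhs y := by
      intro hZ
      obtain ⟨s, hs, hZs⟩ := mem_rhs.1 hZ
      by_cases hsZ : s.1 = Z
      · exact hret s hs hsZ (.base Z (Multiset.mem_add.2 (Or.inl hZs)))
      · rcases key _ (hr s hs) with h | ⟨r, hry, hrZ, h⟩
        · exact hsZ h
        · exact hret r hry hrZ (.step s Z (Multiset.mem_filter.2 ⟨hs, hsZ⟩) h hZs)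
    have hZM : Z ∉ M := fun h => hret r₀ hr₀ hr₀Z (.base Z (Multiset.mem_add.2 (Or.inr h)))
    obtain ⟨y', hy'⟩ := Multiset.exists_cons_of_mem hr₀
    have hZy' : ∀ s ∈ y', s.1 ≠ Z := by
      intro s hs hsZ
      have h1 : (lhs y).count Z = 1 := by
        rw [← hb, Multiset.count_add, Multiset.count_cons_self, Multiset.count_eq_zero.2 hZM,
          Multiset.count_eq_zero.2 hZrhs]
      have h2 : Z ∈ lhs y' := Multiset.mem_map.2 ⟨s, hs, hsZ⟩
      rw [hy', lhs, Multiset.map_cons, ← lhs, hr₀Z, Multiset.count_cons_self] at h1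
      have := Multiset.count_pos.2 h2
      omega
    refine ⟨r₀, y', hy', hr₀Z, fun s hs => ?_⟩
    rcases key _ (hr s (by rw [hy']; exact Multiset.mem_cons_of_mem hs)) with h | ⟨r, hry, hrZ, h⟩
    · exact absurd h (hZy' s hs)
    · have : r = r₀ := by
        rw [hy', Multiset.mem_cons] at hry
        exact hry.resolve_right fun h => hZy' r h hrZ
      subst this
      exact h.mono (fun _ h => h) (hsub hy' hr₀Z)

/-- A balanced and connected multiset of rules is used by some derivation. -/
theorem der_of_balance_of_reach {M : Multiset N} {y : Multiset (Rule N α)}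
    (hb : M + rhs y = lhs y) (hr : ∀ r ∈ y, Reach M y r.1) : Der M y := by
  induction hn : y.card generalizing M y with
  | zero =>
    obtain rfl := Multiset.card_eq_zero.1 hn
    obtain rfl : M = 0 := by simpa [rhs, lhs] using hb
    exact .nil
  | succ n ih =>
    -- From the empty multiset nothing is reachable, so the nonempty `y` rules this case out.
    -- Otherwise any nonterminal of `M` may be expanded first.
    rcases M.empty_or_exists_mem with rfl | ⟨Z, hZ⟩
    · exfalso
      have key : ∀ V, ¬ Reach 0 y V := by
        intro V hV
        induction hV with
        | base V hV => simp at hV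
        | step _ _ _ _ _ ih => exact ih
      obtain ⟨r, hry⟩ := Multiset.card_pos_iff_exists_mem.1 (by omega : 0 < y.card)
      exact key _ (hr r hry)
    · obtain ⟨M, rfl⟩ := Multiset.exists_cons_of_mem hZ
      obtain ⟨r, y, rfl, rfl, hr'⟩ := exists_rule_keeping_reach hb hr
      refine .cons r M y (ih ?_ hr' (by simpa using hn))
      rw [rhs, lhs, Multiset.map_cons, Multiset.map_cons, Multiset.sum_cons, ← rhs, ← lhs,
        Multiset.cons_add, Multiset.cons_inj_right] at hb
      rw [← hb]
      abel

/-! ### Connected lists of rules -/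

/-- Every rule can be applied after the later members of the list have been applied to `M`. -/
inductive Connected (M : List N) : List (Rule N α) → Prop
  | nil : Connected M []
  | cons (r : Rule N α) (l : List (Rule N α)) : Connected M l →
      r.1 ∈ M ++ l.flatMap (fun s => s.2.2) → Connected M (r :: l)

theorem Connected.reach {M : List N} {l : List (Rule N α)} (h : Connected M l) :
    ∀ r ∈ l, Reach (M : Multiset N) (l : Multiset (Rule N α)) r.1 := by
  induction h with
  | nil => simp
  | cons r l _ hr ih =>
    have ih' : ∀ s ∈ l, Reach (M : Multiset N) ((r :: l : List _) : Multiset (Rule N α)) s.1 :=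
      fun s hs => (ih s hs).mono (fun _ h => h) (fun _ h => List.mem_cons_of_mem _ h)
    intro s hs
    rcases List.mem_cons.1 hs with rfl | hs
    · rcases List.mem_append.1 hr with hr | hr
      · exact .base _ hr
      · obtain ⟨t, ht, hst⟩ := List.mem_flatMap.1 hr
        exact .step t _ (List.mem_cons_of_mem _ ht) (ih' t ht) hst
    · exact ih' s hs

/-- The rules of a derivation, each listed once, in reverse order of first use. Connectedness never
consumes nonterminals, so it is enough that `L` contains those of `M`. -/
theorem exists_connected_of_der {M : Multiset N} {y : Multiset (Rule N α)} (h : Der M y)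
    (L : List N) (hL : ∀ Z ∈ M, Z ∈ L) :
    ∃ l : List (Rule N α), l.Nodup ∧ Connected L l ∧ ∀ r, r ∈ l ↔ r ∈ y := by
  classical
  induction h generalizing L with
  | nil => exact ⟨[], by simp, .nil, by simp⟩
  | cons r M y _ ih =>
    obtain ⟨l, h1, h2, h3⟩ := ih (r.2.2 ++ L) (fun Z hZ => by
      rcases Multiset.mem_add.1 hZ with hZ | hZ
      · exact List.mem_append_left _ hZ
      · exact List.mem_append_right _ (hL Z (Multiset.mem_cons_of_mem hZ)))
    -- The rule `r` is applied first, so it moves to the end of the list; there its right side is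
    -- available to all other rules, and its later copies can be dropped.
    have key : ∀ l : List (Rule N α), Connected (r.2.2 ++ L) l →
        Connected L (l.filter (fun s => s ≠ r) ++ [r]) := by
      intro l hl
      induction hl with
      | nil => exact .cons r [] .nil (by simpa using hL r.1 (Multiset.mem_cons_self _ _))
      | cons s l _ hs ih =>
        by_cases hsr : s = r
        · simpa [hsr] using ih
        · rw [List.filter_cons_of_pos (by simpa using hsr), List.cons_append]
          refine .cons s _ ih ?_
          simp only [List.mem_append, List.mem_flatMap, List.mem_filter, List.mem_singleton] at hs ⊢
          rcases hs with (hs | hs) | ⟨t, ht, hst⟩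
          · exact Or.inr ⟨r, Or.inr rfl, hs⟩
          · exact Or.inl hs
          · by_cases htr : t = r
            · exact Or.inr ⟨r, Or.inr rfl, htr ▸ hst⟩
            · exact Or.inr ⟨t, Or.inl ⟨ht, by simpa using htr⟩, hst⟩
    refine ⟨_, ?_, key l h2, fun s => ?_⟩
    · rw [List.nodup_append]
      refine ⟨h1.filter _, by simp, ?_⟩
      rintro a ha b hb rfl
      simp at ha hb
      exact ha.2 hb
    · by_cases hs : s = r <;> simp [hs, h3]

section Algorithm

/-- The connected lists of at most `n` rules. -/
def connectedLists [DecidableEq N] (X : N) (rules : List (Rule N α)) : ℕ → List (List (Rule N α))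
  | 0 => [[]]
  | n + 1 => [] :: (connectedLists X rules n).flatMap fun l => rules.flatMap fun r =>
      bif (X :: l.flatMap fun s => s.2.2).elem r.1 then [r :: l] else []

theorem mem_connectedLists [DecidableEq N] {X : N} {rules : List (Rule N α)} {n : ℕ}
    {l : List (Rule N α)} :
    l ∈ connectedLists X rules n ↔ l.length ≤ n ∧ (∀ r ∈ l, r ∈ rules) ∧ Connected [X] l := by
  induction n generalizing l with
  | zero =>
    simp only [connectedLists, List.mem_singleton, Nat.le_zero, List.length_eq_zero_iff]
    exact ⟨by rintro rfl; exact ⟨rfl, by simp, .nil⟩, fun h => h.1⟩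
  | succ n ih =>
    cases l with
    | nil => simpa [connectedLists] using Connected.nil
    | cons r l =>
      simp only [connectedLists, List.mem_cons, reduceCtorEq, false_or, List.mem_flatMap,
        Bool.cond_eq_ite, List.elem_iff]
      constructor
      · rintro ⟨l', hl', r', hr', h⟩
        split_ifs at h with hc
        · simp only [List.mem_singleton, List.cons.injEq] at h
          obtain ⟨rfl, rfl⟩ := h
          obtain ⟨h1, h2, h3⟩ := ih.1 hl'
          refine ⟨by simpa using h1, ?_, .cons _ _ h3 (by simpa using hc)⟩
          rintro s (rfl | hs)
          · exact hr'
          · exact h2 s hs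
        · simp at h
      · rintro ⟨h1, h2, h3⟩
        cases h3 with
        | cons _ _ h3 h4 =>
          refine ⟨l, ih.2 ⟨by simpa using h1, fun s hs => h2 s (Or.inr hs), h3⟩, r,
            h2 r (Or.inl rfl), ?_⟩
          rw [if_pos (by simpa using h4)]
          simp

/-- Letters, produced nonterminals and consumed nonterminals. -/
abbrev BalanceSymbol (N α : Type*) := α ⊕ N ⊕ N

/-- The letters produced by a rule, followed by its effect on the nonterminals. -/
def ruleWord (r : Rule N α) : List (BalanceSymbol N α) :=
  r.2.1.map Sum.inl ++ Sum.inr (Sum.inr r.1) :: r.2.2.map fun Z => Sum.inr (Sum.inl Z)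

/-- The uses of connected sets of rules. -/
def connectedReps [DecidableEq N] (X : N) (rules : List (Rule N α)) :
    List (LinRep (BalanceSymbol N α)) :=
  (connectedLists X rules rules.length).map fun l =>
    -- The start symbol counts as produced once. Every rule of `l` is used at least once, which
    -- secures reachability; further uses are the periods.
    (Sum.inr (Sum.inl X) :: l.flatMap ruleWord, l.map ruleWord)

/-- Every nonterminal is consumed as often as it is produced. -/
def balanceEquations (X : N) (rules : List (Rule N α)) :
    List (BalanceSymbol N α × BalanceSymbol N α) :=
  (X :: rules.flatMap fun r => r.1 :: r.2.2).map fun Z => (Sum.inr (Sum.inl Z), Sum.inr (Sum.inr Z))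

/-- The letters among the symbols. -/
def letter? (s : BalanceSymbol N α) : Option α := s.getLeft?

/-- The multisets of letters generated from `X`. -/
def parikhReps [DecidableEq N] [DecidableEq α] (X : N) (rules : List (Rule N α)) :
    List (LinRep α) :=
  (restrictEqs (balanceEquations X rules) (connectedReps X rules)).map (project letter?)

/-- The balance symbols of a multiset of rules. -/
def balanceWord (y : Multiset (Rule N α)) : Multiset (BalanceSymbol N α) :=
  (y.map fun r => (ruleWord r : Multiset (BalanceSymbol N α))).sum

theorem balanceWord_cons (r : Rule N α) (y : Multiset (Rule N α)) :
    balanceWord (r ::ₘ y) = ↑(ruleWord r) + balanceWord y := by simp [balanceWord]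

theorem balanceWord_coe (l : List (Rule N α)) :
    balanceWord (l : Multiset (Rule N α)) = ↑(l.flatMap ruleWord) := by
  induction l with
  | nil => simp [balanceWord]
  | cons r l ih => rw [← Multiset.cons_coe, balanceWord_cons, ih]; simp

theorem coe_ruleWord (r : Rule N α) : (ruleWord r : Multiset (BalanceSymbol N α)) =
    (r.2.1 : Multiset α).map Sum.inl + Sum.inr (Sum.inr r.1) ::ₘ
      (r.2.2 : Multiset N).map fun Z => Sum.inr (Sum.inl Z) := by
  simp [ruleWord]

theorem filterMap_balanceWord (y : Multiset (Rule N α)) :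
    (balanceWord y).filterMap letter? = output y := by
  induction y using Multiset.induction_on with
  | empty => simp [balanceWord, output]
  | cons r y ih =>
    have h1 : (r.2.1.map Sum.inl).filterMap (letter? : BalanceSymbol N α → Option α) = r.2.1 := by
      rw [List.filterMap_map]
      exact List.filterMap_some
    have h2 : (r.2.2.map fun Z => Sum.inr (Sum.inl Z)).filterMap
        (letter? : BalanceSymbol N α → Option α) = [] := by
      rw [List.filterMap_map]
      exact List.filterMap_eq_nil_iff.2 fun _ _ => rfl
    rw [balanceWord_cons, Multiset.filterMap_add, ih, output_cons, Multiset.filterMap_coe, ruleWord,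
      List.filterMap_append, h1, List.filterMap_cons_none (by rfl), h2, List.append_nil]

theorem count_produced [DecidableEq N] [DecidableEq α] (Z : N) (y : Multiset (Rule N α)) :
    (balanceWord y).count (Sum.inr (Sum.inl Z)) = (rhs y).count Z := by
  induction y using Multiset.induction_on with
  | empty => simp [balanceWord, rhs]
  | cons r y ih =>
    have h1 : ((r.2.2 : Multiset N).map fun Z => (Sum.inr (Sum.inl Z) : BalanceSymbol N α)).count
        (Sum.inr (Sum.inl Z)) = (r.2.2 : Multiset N).count Z :=
      Multiset.count_map_eq_count' (fun Z => (Sum.inr (Sum.inl Z) : BalanceSymbol N α)) _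
        (fun a b h => by simpa using h) Z
    have h2 : ((r.2.1 : Multiset α).map (Sum.inl : α → BalanceSymbol N α)).count
        (Sum.inr (Sum.inl Z)) = 0 := Multiset.count_eq_zero.2 (by simp)
    rw [balanceWord_cons, Multiset.count_add, ih, rhs, rhs, Multiset.map_cons, Multiset.sum_cons,
      Multiset.count_add, coe_ruleWord, Multiset.count_add, Multiset.count_cons_of_ne (by simp), h1,
      h2, zero_add]

theorem count_consumed [DecidableEq N] [DecidableEq α] (Z : N) (y : Multiset (Rule N α)) :
    (balanceWord y).count (Sum.inr (Sum.inr Z)) = (lhs y).count Z := by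
  induction y using Multiset.induction_on with
  | empty => simp [balanceWord, lhs]
  | cons r y ih =>
    have h1 : ((r.2.2 : Multiset N).map fun Z => (Sum.inr (Sum.inl Z) : BalanceSymbol N α)).count
        (Sum.inr (Sum.inr Z)) = 0 := Multiset.count_eq_zero.2 (by simp)
    have h2 : ((r.2.1 : Multiset α).map (Sum.inl : α → BalanceSymbol N α)).count
        (Sum.inr (Sum.inr Z)) = 0 := Multiset.count_eq_zero.2 (by simp)
    rw [balanceWord_cons, Multiset.count_add, ih, lhs, lhs, Multiset.map_cons, Multiset.count_cons,
      coe_ruleWord, Multiset.count_add, Multiset.count_cons, h1, h2]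
    simp only [Sum.inr.injEq]
    omega

theorem mem_semiSet_connectedReps [DecidableEq N] {X : N} {rules : List (Rule N α)}
    {x : Multiset (BalanceSymbol N α)} :
    x ∈ semiSet (connectedReps X rules) ↔ ∃ (l : List (Rule N α)) (y : Multiset (Rule N α)),
      l.length ≤ rules.length ∧ (∀ r ∈ l, r ∈ rules) ∧ Connected [X] l ∧ (∀ r ∈ y, r ∈ l) ∧
      x = Sum.inr (Sum.inl X) ::ₘ balanceWord ((l : Multiset (Rule N α)) + y) := by
  simp only [semiSet, linSet, connectedReps, Set.mem_ofPred_eq, List.mem_map]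
  constructor
  · rintro ⟨_, ⟨l, hl, rfl⟩, w, hw, rfl⟩
    obtain ⟨h1, h2, h3⟩ := mem_connectedLists.1 hl
    simp only [List.mem_map] at hw
    obtain ⟨e, he, rfl⟩ := exists_map_eq_of_forall hw
    refine ⟨l, (e : Multiset (Rule N α)), h1, h2, h3, by simpa using he, ?_⟩
    rw [Multiset.coe_add, balanceWord_coe, List.flatMap_append, ← List.flatMap_def]
    simp
  · rintro ⟨l, y, h1, h2, h3, h4, rfl⟩
    induction y using Quotient.inductionOn with | _ e
    refine ⟨_, ⟨l, mem_connectedLists.2 ⟨h1, h2, h3⟩, rfl⟩, e.map ruleWord, ?_, ?_⟩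
    · simp only [List.mem_map, forall_exists_index, and_imp, forall_apply_eq_imp_iff₂]
      exact fun r hr => ⟨r, h4 r hr, rfl⟩
    · simp only [Multiset.quot_mk_to_coe, Multiset.coe_add, balanceWord_coe, List.flatMap_append,
        ← List.flatMap_def]
      simp

/-- Restricting by the balance equations leaves exactly the balanced rule multisets `l + y` with `l`
connected. `der_of_balance_of_reach` turns them into derivations; conversely, the support of a
derivation is a connected list and its remaining rule uses are periods. -/
theorem mem_semiSet_parikhReps [DecidableEq N] [DecidableEq α] {X : N} {rules : List (Rule N α)}
    {x : Multiset α} :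
    x ∈ semiSet (parikhReps X rules) ↔
      ∃ y : Multiset (Rule N α), (∀ r ∈ y, r ∈ rules) ∧ Der {X} y ∧ x = output y := by
  rw [parikhReps, mem_semiSet_project, semiSet_restrictEqs]
  constructor
  · rintro ⟨_, ⟨hx, hbal⟩, rfl⟩
    obtain ⟨l, y, h1, h2, h3, h4, rfl⟩ := mem_semiSet_connectedReps.1 hx
    refine ⟨↑l + y, ?_, der_of_balance_of_reach ?_ ?_, ?_⟩
    · intro r hr
      rcases Multiset.mem_add.1 hr with hr | hr
      · exact h2 r hr
      · exact h2 r (h4 r hr)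
    · have hmem : ∀ r ∈ (↑l + y : Multiset (Rule N α)), r ∈ rules := by
        intro r hr
        rcases Multiset.mem_add.1 hr with hr | hr
        · exact h2 r hr
        · exact h2 r (h4 r hr)
      ext Z
      by_cases hZ : Z ∈ X :: rules.flatMap fun r => r.1 :: r.2.2
      · have := hbal _ (List.mem_map.2 ⟨Z, hZ, rfl⟩)
        simp only [Multiset.count_cons, count_produced, count_consumed] at this
        rw [Multiset.count_add, ← Multiset.cons_zero, Multiset.count_cons]
        simpa [add_comm] using this
      -- No equation is imposed on a nonterminal that is neither `X` nor in a rule, but both of its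
      -- counts are zero.
      · simp only [List.mem_cons, List.mem_flatMap, not_or, not_exists, not_and] at hZ
        rw [Multiset.count_eq_zero.2, Multiset.count_eq_zero.2]
        · simp only [lhs, Multiset.mem_map, not_exists, not_and]
          exact fun r hr h => (hZ.2 r (hmem r hr)).1 h.symm
        · simp only [Multiset.mem_add, Multiset.mem_singleton, not_or]
          refine ⟨hZ.1, fun h => ?_⟩
          obtain ⟨s, hs, hZs⟩ := mem_rhs.1 h
          exact (hZ.2 s (hmem s hs)).2 hZs
    · intro r hr
      have hrl : r ∈ l := (Multiset.mem_add.1 hr).elim id (h4 r)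
      exact (h3.reach r hrl).mono (by simp) (fun s hs => Multiset.mem_add.2 (Or.inl hs))
    · rw [← Multiset.singleton_add, Multiset.filterMap_add, filterMap_balanceWord]
      simp [letter?, ← Multiset.cons_zero, Multiset.filterMap_cons]
  · rintro ⟨y, hy, hder, rfl⟩
    classical
    obtain ⟨l, h1, h2, h3⟩ := exists_connected_of_der hder [X] (by simp)
    have hle : (l : Multiset (Rule N α)) ≤ y := by
      rw [Multiset.le_iff_subset (by simpa using h1)]
      exact fun r hr => (h3 r).1 hr
    obtain ⟨e, rfl⟩ := Multiset.le_iff_exists_add.1 hle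
    refine ⟨Sum.inr (Sum.inl X) ::ₘ balanceWord ((l : Multiset (Rule N α)) + e), ⟨?_, ?_⟩, ?_⟩
    · refine mem_semiSet_connectedReps.2 ⟨l, e, ?_, fun r hr => hy r ((h3 r).1 hr), h2,
        fun r hr => (h3 r).2 (Multiset.mem_add.2 (Or.inr hr)), rfl⟩
      -- Without repetitions the list is no longer than `rules`, the bound used in `connectedReps`.
      exact (h1.subperm fun r hr => hy r ((h3 r).1 hr)).length_le
    · simp only [balanceEquations, List.mem_map, forall_exists_index, and_imp,
        forall_apply_eq_imp_iff₂]
      intro Z _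
      have := congrArg (Multiset.count Z) hder.balance
      rw [Multiset.count_add, ← Multiset.cons_zero, Multiset.count_cons] at this
      simp only [Multiset.count_cons, count_produced, count_consumed]
      simpa [add_comm] using this
    · rw [← Multiset.singleton_add, Multiset.filterMap_add, filterMap_balanceWord]
      simp [letter?, ← Multiset.cons_zero, Multiset.filterMap_cons]

end Algorithm

end CommutativeGrammar

/-! ### Outputs of pushdown runs, by the triple construction. -/

namespace PushdownSystem

open SemilinearWords CommutativeGrammar

/-- Moves `(p, v, q)` from `p` to `q` with output `v` which do not touch the stack. -/
abbrev InternalMove (Q α : Type*) := Q × List α × Q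

/-- Moves `(p, f, v, q)` from `p` to `q` with output `v` which push or pop `f`. -/
abbrev StackMove (Q I α : Type*) := Q × I × List α × Q

/-- A pushdown system: the internal moves, the pushing moves and the popping moves. -/
abbrev System (Q I α : Type*) :=
  List (InternalMove Q α) × List (StackMove Q I α) × List (StackMove Q I α)

variable {Q I α : Type*}

/-- `Run D r δ p γ x`: there is a run from state `p` and stack `γ` to state `r` and stack `δ` with
output `x`. -/
inductive Run (D : System Q I α) (r : Q) (δ : List I) : Q → List I → Multiset α → Prop
  | refl : Run D r δ r δ 0
  | internal {p q : Q} {v : List α} {γ : List I} {x : Multiset α} : (p, v, q) ∈ D.1 →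
      Run D r δ q γ x → Run D r δ p γ (↑v + x)
  | push {p q : Q} {f : I} {v : List α} {γ : List I} {x : Multiset α} : (p, f, v, q) ∈ D.2.1 →
      Run D r δ q (f :: γ) x → Run D r δ p γ (↑v + x)
  | pop {p q : Q} {f : I} {v : List α} {γ : List I} {x : Multiset α} : (p, f, v, q) ∈ D.2.2 →
      Run D r δ q γ x → Run D r δ p (f :: γ) (↑v + x)

theorem Run.trans {D : System Q I α} {p q r : Q} {γ δ ε : List I} {x y : Multiset α}
    (h : Run D q δ p γ x) (h' : Run D r ε q δ y) : Run D r ε p γ (x + y) := by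
  induction h with
  | refl => simpa using h'
  | internal hm _ ih => rw [add_assoc]; exact .internal hm ih
  | push hm _ ih => rw [add_assoc]; exact .push hm ih
  | pop hm _ ih => rw [add_assoc]; exact .pop hm ih

/-- The states in which a matched part of a run to `r` may end. -/
def endStates (D : System Q I α) (r : Q) : List Q := r :: D.2.2.map fun b => b.1

/-- The commutative grammar whose nonterminals `(p, q)` generate the outputs of the runs from `p`
to `q` which do not change the stack. -/
def matchedRules [DecidableEq I] (D : System Q I α) (r : Q) : List (Rule (Q × Q) α) :=
  -- The type of states may be infinite, so end states are guessed from a finite list only: a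
  -- matched part of a run to `r` stops at `r` or just before a pop.
  (endStates D r).map (fun p => ((p, p), [], [])) ++
  (D.1.flatMap fun a => (endStates D r).map fun s => ((a.1, s), a.2.1, [(a.2.2, s)])) ++
  D.2.1.flatMap fun a => D.2.2.flatMap fun b => bif a.2.1 == b.2.1 then
    (endStates D r).map fun s => ((a.1, s), a.2.2.1 ++ b.2.2.1, [(a.2.2.2, b.1), (b.2.2.2, s)])
    else []

theorem mem_matchedRules [DecidableEq I] {D : System Q I α} {r : Q} {R : Rule (Q × Q) α} :
    R ∈ matchedRules D r ↔ (∃ p ∈ endStates D r, R = ((p, p), [], [])) ∨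
      (∃ p q v, (p, v, q) ∈ D.1 ∧ ∃ s ∈ endStates D r, R = ((p, s), v, [(q, s)])) ∨
      ∃ p q f v p' q' v', (p, f, v, q) ∈ D.2.1 ∧ (p', f, v', q') ∈ D.2.2 ∧
        ∃ s ∈ endStates D r, R = ((p, s), v ++ v', [(q, p'), (q', s)]) := by
  simp only [matchedRules, List.mem_append, List.mem_map, List.mem_flatMap, Prod.exists,
    Bool.cond_eq_ite, beq_iff_eq, or_assoc]
  refine or_congr ⟨?_, ?_⟩ (or_congr ⟨?_, ?_⟩ ⟨?_, ?_⟩)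
  · rintro ⟨p, hp, rfl⟩; exact ⟨p, hp, rfl⟩
  · rintro ⟨p, hp, rfl⟩; exact ⟨p, hp, rfl⟩
  · rintro ⟨p, v, q, h, s, hs, rfl⟩; exact ⟨p, q, v, h, s, hs, rfl⟩
  · rintro ⟨p, q, v, h, s, hs, rfl⟩; exact ⟨p, v, q, h, s, hs, rfl⟩
  · rintro ⟨p, f, v, q, h, p', f', v', q', h', hR⟩
    split_ifs at hR with hf
    · obtain rfl : f = f' := hf
      obtain ⟨s, hs, rfl⟩ := List.mem_map.1 hR
      exact ⟨p, q, f, v, p', q', v', h, h', s, hs, rfl⟩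
    · simp at hR
  · rintro ⟨p, q, f, v, p', q', v', h, h', s, hs, rfl⟩
    exact ⟨p, f, v, q, h, p', f, v', q', h', by
      simpa using hs⟩

/-- `Matched D r p q x`: the nonterminal `(p, q)` generates `x`. -/
def Matched [DecidableEq I] (D : System Q I α) (r p q : Q) (x : Multiset α) : Prop :=
  ∃ y : Multiset (Rule (Q × Q) α), (∀ R ∈ y, R ∈ matchedRules D r) ∧ Der {(p, q)} y ∧ x = output y

section Matched

variable [DecidableEq I] {D : System Q I α} {r : Q}

theorem Matched.refl {p : Q} (hp : p ∈ endStates D r) : Matched D r p p 0 :=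
  ⟨{((p, p), [], [])}, by simpa using mem_matchedRules.2 (Or.inl ⟨p, hp, rfl⟩),
    .cons ((p, p), [], []) 0 0 (by simpa using Der.nil), by simp [output]⟩

theorem Matched.internal {p q s : Q} {v : List α} {x : Multiset α} (hm : (p, v, q) ∈ D.1)
    (hs : s ∈ endStates D r) (h : Matched D r q s x) : Matched D r p s (↑v + x) := by
  obtain ⟨y, hy, hd, rfl⟩ := h
  refine ⟨((p, s), v, [(q, s)]) ::ₘ y, ?_, .cons ((p, s), v, [(q, s)]) 0 y
    (by simpa using hd), by simp⟩
  rw [Multiset.forall_mem_cons]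
  exact ⟨mem_matchedRules.2 (Or.inr (Or.inl ⟨p, q, v, hm, s, hs, rfl⟩)), hy⟩

theorem Matched.push {p q p' q' s : Q} {f : I} {v v' : List α} {x x' : Multiset α}
    (hm : (p, f, v, q) ∈ D.2.1) (hm' : (p', f, v', q') ∈ D.2.2) (hs : s ∈ endStates D r)
    (h : Matched D r q p' x) (h' : Matched D r q' s x') :
    Matched D r p s (↑v + (x + (↑v' + x'))) := by
  obtain ⟨y, hy, hd, rfl⟩ := h
  obtain ⟨y', hy', hd', rfl⟩ := h'
  refine ⟨((p, s), v ++ v', [(q, p'), (q', s)]) ::ₘ (y + y'), ?_,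
    .cons ((p, s), v ++ v', [(q, p'), (q', s)]) 0 _ (by
      simpa [← Multiset.cons_coe] using hd.add hd'), ?_⟩
  · rw [Multiset.forall_mem_cons]
    refine ⟨mem_matchedRules.2 (Or.inr (Or.inr ⟨p, q, f, v, p', q', v', hm, hm', s, hs, rfl⟩)), ?_⟩
    intro R hR
    exact (Multiset.mem_add.1 hR).elim (hy R) (hy' R)
  · rw [output_cons, output_add, ← Multiset.coe_add]
    abel

/-- A run to state `r` and the empty stack, cut at the moves which remove the initial stack. -/
inductive Chain (D : System Q I α) (r : Q) : Q → List I → Multiset α → Prop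
  | nil {p : Q} {x : Multiset α} : Matched D r p r x → Chain D r p [] x
  | cons {p p' q' : Q} {f : I} {v : List α} {γ : List I} {x x' : Multiset α} :
      Matched D r p p' x → (p', f, v, q') ∈ D.2.2 → Chain D r q' γ x' →
      Chain D r p (f :: γ) (x + (↑v + x'))

/-- Only the first matched part of the chain changes. It ends in `r` or in the source of a pop,
hence in a member of `endStates D r`. -/
theorem Chain.prepend {p q : Q} {γ : List I} {u x : Multiset α} (h : Chain D r q γ x)
    (hpq : ∀ s ∈ endStates D r, ∀ x, Matched D r q s x → Matched D r p s (u + x)) :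
    Chain D r p γ (u + x) := by
  cases h with
  | nil h => exact .nil (hpq r (List.mem_cons_self ..) _ h)
  | cons h hm hc =>
    rw [← add_assoc]
    exact .cons (hpq _ (List.mem_cons_of_mem _ (List.mem_map.2 ⟨_, hm, rfl⟩)) _ h) hm hc

theorem Run.chain {p : Q} {γ : List I} {x : Multiset α} (h : Run D r [] p γ x) :
    Chain D r p γ x := by
  induction h with
  | refl => exact .nil (.refl (List.mem_cons_self ..))
  | internal hm _ ih => exact ih.prepend fun s hs x hx => hx.internal hm hs
  -- The first link of the chain on `f :: γ` ends with the pop of the pushed `f`. Push, link and pop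
  -- together are one matched part in front of the rest.
  | push hm _ ih =>
    cases ih with
    | cons h hm' hc =>
      rw [← add_assoc, ← add_assoc]
      refine hc.prepend fun s hs x hx => ?_
      rw [add_assoc, add_assoc]
      exact Matched.push hm hm' hs h hx
  | pop hm _ ih =>
    have := Chain.cons (.refl (List.mem_cons_of_mem _ (List.mem_map.2 ⟨_, hm, rfl⟩))) hm ih
    simpa using this

/-- `Der` treats all pending nonterminals at once, so the induction produces one run for each pair
in `M`. The runs must work above every stack `γ`, because the part between a push and its pop runs
above `f :: γ`. -/
theorem exists_runs_of_der {M : Multiset (Q × Q)} {y : Multiset (Rule (Q × Q) α)} (h : Der M y)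
    (hy : ∀ R ∈ y, R ∈ matchedRules D r) :
    ∃ L : Multiset ((Q × Q) × Multiset α), L.map (fun e => e.1) = M ∧
      (L.map fun e => e.2).sum = output y ∧ ∀ e ∈ L, ∀ γ, Run D e.1.2 γ e.1.1 γ e.2 := by
  classical
  have split : ∀ {L : Multiset ((Q × Q) × Multiset α)} {a : Q × Q} {M : Multiset (Q × Q)},
      L.map (fun e => e.1) = a ::ₘ M → ∃ x L', L = (a, x) ::ₘ L' ∧ L'.map (fun e => e.1) = M := by
    intro L a M hL
    obtain ⟨⟨_, x⟩, he, rfl, h⟩ := (Multiset.map_eq_cons _ _ _ _).2 hL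
    exact ⟨x, _, (Multiset.cons_erase he).symm, h⟩
  induction h with
  | nil => exact ⟨0, by simp⟩
  | cons R M y _ ih =>
    rw [Multiset.forall_mem_cons] at hy
    obtain ⟨L, h1, h2, h3⟩ := ih hy.2
    rcases mem_matchedRules.1 hy.1 with ⟨p, -, rfl⟩ | ⟨p, q, v, hm, s, -, rfl⟩ |
      ⟨p, q, f, v, p', q', v', hm, hm', s, -, rfl⟩
    · refine ⟨((p, p), 0) ::ₘ L, by simpa using h1, by simpa using h2, ?_⟩
      rw [Multiset.forall_mem_cons]
      exact ⟨fun γ => .refl, h3⟩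
    · obtain ⟨x, L, rfl, h4⟩ := split (by simpa using h1)
      rw [Multiset.forall_mem_cons] at h3
      refine ⟨((p, s), ↑v + x) ::ₘ L, by simpa using h4, ?_, ?_⟩
      · rw [output_cons, ← h2]; simp [add_assoc]
      · rw [Multiset.forall_mem_cons]
        exact ⟨fun γ => .internal hm (h3.1 γ), h3.2⟩
    · obtain ⟨x, L, rfl, h4⟩ := split (L := L) (a := (q, p')) (M := (q', s) ::ₘ M) (by
        simpa [← Multiset.cons_coe] using h1)
      obtain ⟨x', L, rfl, h5⟩ := split h4
      rw [Multiset.forall_mem_cons, Multiset.forall_mem_cons] at h3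
      refine ⟨((p, s), ↑v + (x + (↑v' + x'))) ::ₘ L, by simpa using h5, ?_, ?_⟩
      · rw [output_cons, ← h2, ← Multiset.coe_add]
        simp only [Multiset.map_cons, Multiset.sum_cons]
        abel
      · rw [Multiset.forall_mem_cons]
        exact ⟨fun γ => .push hm ((h3.1 (f :: γ)).trans (.pop hm' (h3.2.1 γ))), h3.2.2⟩

theorem run_iff_matched {p : Q} {x : Multiset α} : Run D r [] p [] x ↔ Matched D r p r x := by
  constructor
  · intro h
    cases h.chain with
    | nil h => exact h
  · rintro ⟨y, hy, hd, rfl⟩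
    obtain ⟨L, h1, h2, h3⟩ := exists_runs_of_der hd hy
    obtain ⟨⟨_, x⟩, rfl, rfl⟩ := Multiset.map_eq_singleton.1 h1
    have := h3 _ (Multiset.mem_singleton_self _) []
    rw [← h2]
    simpa using this

end Matched

/-- The outputs of the runs from `p` to `r` which start and end with the empty stack. -/
def runReps [DecidableEq Q] [DecidableEq I] [DecidableEq α] (D : System Q I α) (p r : Q) :
    List (LinRep α) :=
  parikhReps (p, r) (matchedRules D r)

theorem mem_semiSet_runReps [DecidableEq Q] [DecidableEq I] [DecidableEq α] {D : System Q I α}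
    {p r : Q} {x : Multiset α} : x ∈ semiSet (runReps D p r) ↔ Run D r [] p [] x := by
  rw [run_iff_matched, runReps, mem_semiSet_parikhReps, Matched]

end PushdownSystem

namespace CounterIndexedGrammar

open SemilinearWords PushdownSystem

/-! ### Derivations of linear grammars -/

section Linear

variable {V T I : Type*} {k : ℕ}

/-- A word with at most one nonterminal. -/
def linearWord (u : List T) (o : Option V) (v : List T) : List (Symbol T V) :=
  u.map Symbol.terminal ++ o.toList.map Symbol.nonterminal ++ v.map Symbol.terminal

theorem exists_eq_map_terminal {ν : List (Symbol T V)} (h : countNonterminals ν = 0) :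
    ∃ v : List T, ν = v.map Symbol.terminal := by
  induction ν with
  | nil => exact ⟨[], rfl⟩
  | cons s ν ih =>
    cases s with
    | terminal a =>
      obtain ⟨v, hv⟩ := ih (by simpa [countNonterminals] using h)
      exact ⟨a :: v, by rw [hv]; rfl⟩
    | nonterminal A => simp [countNonterminals] at h

theorem exists_eq_linearWord {ν : List (Symbol T V)} (h : countNonterminals ν ≤ 1) :
    ∃ u o v, ν = linearWord u o v := by
  induction ν with
  | nil => exact ⟨[], none, [], rfl⟩
  | cons s ν ih =>
    cases s with
    | terminal a =>
      obtain ⟨u, o, v, rfl⟩ := ih (by simpa [countNonterminals] using h)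
      exact ⟨a :: u, o, v, rfl⟩
    | nonterminal A =>
      obtain ⟨v, rfl⟩ := exists_eq_map_terminal (ν := ν) (by simpa [countNonterminals] using h)
      exact ⟨[], some A, v, rfl⟩

/-- A sentential form with at most one block. -/
def linearForm (x : List T) (o : Option V) (α : List I) (y : List T) : SententialForm V T I :=
  linearWord x (o.map fun A => (A, α)) y

theorem attachIndices_linearWord (α : List I) (u : List T) (o : Option V) (v : List T) :
    attachIndices α (linearWord u o v) = linearForm u o α v := by
  cases o <;> simp [attachIndices, linearForm, linearWord, Function.comp_def]

theorem append_linearForm_append (x u : List T) (o : Option V) (α : List I) (v y : List T) :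
    x.map Symbol.terminal ++ linearForm u o α v ++ y.map Symbol.terminal =
      linearForm (x ++ u) o α (v ++ y) := by
  simp [linearForm, linearWord]

/-- A linear form has at most one block, so the block rewritten by a derivation step and its
surroundings are uniquely determined. -/
theorem eq_of_append_nonterminal_eq_linearForm {x' y' : SententialForm V T I} {P : V × List I}
    {x : List T} {o : Option V} {α : List I} {y : List T}
    (h : x' ++ [Symbol.nonterminal P] ++ y' = linearForm x o α y) :
    o = some P.1 ∧ P.2 = α ∧ x' = x.map Symbol.terminal ∧ y' = y.map Symbol.terminal := by
  have hy : ∀ (z z' : SententialForm V T I), z ++ Symbol.nonterminal P :: z' ≠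
      y.map Symbol.terminal := by
    intro z z' hz
    have : Symbol.nonterminal P ∈ y.map (Symbol.terminal : T → Symbol T (V × List I)) := by
      rw [← hz]; simp
    simp at this
  induction x generalizing x' with
  | nil =>
    cases o with
    | none => exact absurd (by simpa [linearForm, linearWord] using h) (hy x' y')
    | some B =>
      cases x' with
      | nil =>
        simp only [List.nil_append, linearForm, linearWord, Option.map_some, Option.toList_some,
          List.map_cons, List.map_nil, List.cons_append, List.cons.injEq,
          Symbol.nonterminal.injEq] at h
        obtain ⟨rfl, rfl⟩ := h
        simp
      | cons s x' =>
        simp only [List.nil_append, linearForm, linearWord, Option.map_some, Option.toList_some,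
          List.map_cons, List.map_nil, List.cons_append, List.cons.injEq, List.append_assoc] at h
        exact absurd h.2 (hy x' y')
  | cons a x ih =>
    cases x' with
    | nil => simp [linearForm, linearWord] at h
    | cons s x' =>
      simp only [linearForm, linearWord, List.map_cons, List.cons_append, List.cons.injEq] at h
      obtain ⟨h1, h2, h3, h4⟩ := ih (x' := x') (by simpa [linearForm, linearWord] using h.2)
      exact ⟨h1, h2, by rw [h.1, h3]; rfl, h4⟩

/-- `Generates G (some A) α w n`: the block `A α` generates `w` with counter increments `n`. The
state `none` is reached when the nonterminal has disappeared. -/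
inductive Generates (G : CounterIndexedGrammar V T I k) :
    Option V → List I → List T → (Fin k → ℕ) → Prop
  | done (α : List I) : Generates G none α [] 0
  | plain {A : V} {u : List T} {o : Option V} {v : List T} {c : Fin k → ℕ} {α : List I}
      {w : List T} {n : Fin k → ℕ} : .plain A (linearWord u o v) c ∈ G.productions →
      Generates G o α w n → Generates G (some A) α (u ++ w ++ v) (c + n)
  | push {A B : V} {f : I} {c : Fin k → ℕ} {α : List I} {w : List T} {n : Fin k → ℕ} :
      .push A B f c ∈ G.productions → Generates G (some B) (f :: α) w n →
      Generates G (some A) α w (c + n)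
  | pop {A : V} {f : I} {u : List T} {o : Option V} {v : List T} {c : Fin k → ℕ} {α : List I}
      {w : List T} {n : Fin k → ℕ} : .pop A f (linearWord u o v) c ∈ G.productions →
      Generates G o α w n → Generates G (some A) (f :: α) (u ++ w ++ v) (c + n)

variable {G : CounterIndexedGrammar V T I k}

theorem Generates.derives {o : Option V} {α : List I} {w : List T} {m : Fin k → ℕ}
    (h : G.Generates o α w m) (x y : List T) (n : Fin k → ℕ) :
    G.Derives (linearForm x o α y, n) ((x ++ w ++ y).map Symbol.terminal, n + m) := by
  have key : ∀ {p A α μ x y n}, p ∈ G.productions → p.Rewrites A α μ →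
      G.Step (linearForm x (some A) α y, n)
        (x.map Symbol.terminal ++ μ ++ y.map Symbol.terminal, n + p.increments) := by
    intro p A α μ x y n hp hμ
    exact Step.mk p hp A α μ hμ (x.map Symbol.terminal) (y.map Symbol.terminal) n
  induction h generalizing x y n with
  | done α =>
    rw [add_zero]
    have : linearForm x none α y =
        (x ++ [] ++ y).map (Symbol.terminal : T → Symbol T (V × List I)) := by
      simp [linearForm, linearWord]
    rw [this]
    exact Relation.ReflTransGen.refl
  | @plain A u o v c α w m hp _ ih =>
    have hs := key (x := x) (y := y) (n := n) hp (.plain _ _ _ α)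
    rw [attachIndices_linearWord, append_linearForm_append] at hs
    have : G.Derives _ _ := Relation.ReflTransGen.head hs (ih _ _ _)
    simpa [CounterProduction.increments, add_assoc] using this
  | @push A B f c α w m hp _ ih =>
    have hs := key (x := x) (y := y) (n := n) hp (.push _ _ _ _ α)
    have : G.Derives _ _ := Relation.ReflTransGen.head hs (ih _ _ _)
    simpa [CounterProduction.increments, add_assoc] using this
  | @pop A f u o v c α w m hp _ ih =>
    have hs := key (x := x) (y := y) (n := n) hp (.pop _ _ _ _ α)
    rw [attachIndices_linearWord, append_linearForm_append] at hs
    have : G.Derives _ _ := Relation.ReflTransGen.head hs (ih _ _ _)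
    simpa [CounterProduction.increments, add_assoc] using this

/-- Every step keeps the form linear, and the terminals `x` and `y` around the block stay in place
to the end. Reading the derivation from its head therefore gives `Generates` for the block alone. -/
theorem IsLinear.generates_of_derives (hG : G.IsLinear) {u : List T} {n' : Fin k → ℕ}
    {s : SententialForm V T I × (Fin k → ℕ)} (h : G.Derives s (u.map Symbol.terminal, n'))
    {x : List T} {o : Option V} {α : List I} {y : List T} {n : Fin k → ℕ}
    (hs : s = (linearForm x o α y, n)) :
    ∃ w m, u = x ++ w ++ y ∧ n' = n + m ∧ G.Generates o α w m := by
  induction h using Relation.ReflTransGen.head_induction_on generalizing x o α y n with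
  | refl =>
    rw [Prod.mk.injEq] at hs
    cases o with
    | none =>
      refine ⟨[], 0, ?_, by simp [hs.2], .done α⟩
      have : Function.Injective (Symbol.terminal : T → Symbol T (V × List I)) :=
        fun a b h => by simpa using h
      refine this.list_map ?_
      simpa [linearForm, linearWord] using hs.1
    | some A =>
      have : Symbol.nonterminal (A, α) ∈ u.map (Symbol.terminal : T → Symbol T (V × List I)) := by
        rw [hs.1]; simp [linearForm, linearWord]
      simp at this
  | head hstep _ ih =>
    obtain ⟨p, hp, A, β, μ, hμ, x', y', n₁⟩ := hstep
    rw [Prod.mk.injEq] at hs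
    obtain ⟨hs, rfl⟩ := hs
    obtain ⟨rfl, rfl, rfl, rfl⟩ := eq_of_append_nonterminal_eq_linearForm hs
    have hlin := hG p hp
    cases hμ with
    | plain _ ν c =>
      obtain ⟨u', o, v', rfl⟩ := exists_eq_linearWord hlin
      obtain ⟨w, m, rfl, rfl, hw⟩ := ih (by
        rw [attachIndices_linearWord, append_linearForm_append])
      exact ⟨u' ++ w ++ v', c + m, by simp, by simp [CounterProduction.increments, add_assoc],
        .plain hp hw⟩
    | push _ B f c =>
      obtain ⟨w, m, rfl, rfl, hw⟩ := ih (x := x) (y := y) (o := some B) (α := f :: β)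
        (by simp [linearForm, linearWord]; rfl)
      exact ⟨w, c + m, by simp, by simp [CounterProduction.increments, add_assoc], .push hp hw⟩
    | pop _ f ν c =>
      obtain ⟨u', o, v', rfl⟩ := exists_eq_linearWord hlin
      obtain ⟨w, m, rfl, rfl, hw⟩ := ih (by
        rw [attachIndices_linearWord, append_linearForm_append])
      exact ⟨u' ++ w ++ v', c + m, by simp, by simp [CounterProduction.increments, add_assoc],
        .pop hp hw⟩

theorem IsLinear.mem_language_iff (hG : G.IsLinear) {w : List T} :
    w ∈ G.language ↔ ∃ n : Fin k → ℕ, G.Generates (some G.start) [] w n ∧ ∀ i j, n i = n j := by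
  constructor
  · rintro ⟨n, h, hn⟩
    obtain ⟨w', m, rfl, rfl, hw⟩ := hG.generates_of_derives h (x := []) (y := [])
      (o := some G.start) (α := []) (n := 0) rfl
    exact ⟨m, by simpa using hw, by simpa using hn⟩
  · rintro ⟨n, h, hn⟩
    refine ⟨n, ?_, hn⟩
    have := h.derives [] [] 0
    simpa [linearForm, linearWord] using this

theorem Generates.eq_nil {o : Option V} {α : List I} {w : List T} {n : Fin k → ℕ}
    (h : G.Generates o α w n) (ho : o = none) : w = [] ∧ n = 0 := by
  subst ho
  cases h
  exact ⟨rfl, rfl⟩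

end Linear

/-! ### The pushdown system of a grammar code -/

/-- Outputs: terminals and counter increments. -/
abbrev Letter := ℕ ⊕ ℕ

/-- A nonterminal with the word it has to generate (or the empty word, if all words are
admitted), or the final state. -/
abbrev State := Option (ℕ × List ℕ)

/-- A word in which the `i`-th counter symbol occurs `c[i]` times. -/
def counterWord (c : List ℕ) : List Letter :=
  (List.range c.length).flatMap fun i => (List.range (c.getD i 0)).map fun _ => Sum.inr i

/-- The output of a production. -/
def outputWord (ν : List (ℕ ⊕ ℕ)) (c : List ℕ) : List Letter :=
  (ν.filterMap Sum.getLeft?).map Sum.inl ++ counterWord c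

/-- The state after a production, if the nonterminal has to generate `z`. -/
def targetState (ν : List (ℕ ⊕ ℕ)) (z : List ℕ) : State :=
  (ν.filterMap Sum.getRight?).head?.map fun B => (B, z)

/-- The part of a state determined by the generated word. -/
def key (b : Bool) (w : List ℕ) : List ℕ := bif b then w else []

/-- The key before a production, if the nonterminal has to generate `z`. -/
def sourceKey (b : Bool) (ν : List (ℕ ⊕ ℕ)) (z : List ℕ) : List ℕ :=
  key b (ν.flatMap fun s => Sum.casesOn s (fun a => [a]) fun _ => z)

/-- The moves for the productions `A → (ν, c)`. -/
def plainMoves (b : Bool) (zs : List (List ℕ)) (q : ℕ × List (ℕ ⊕ ℕ) × List ℕ) :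
    List (InternalMove State Letter) :=
  -- The key is guessed from the inside: `z` is the word left to the nonterminal of the right side,
  -- and the key before the move is the right side with `z` put in its place. If there is no
  -- nonterminal, the target is `none` and `z` plays no role.
  zs.map fun z => (some (q.1, sourceKey b q.2.1 z), outputWord q.2.1 q.2.2, targetState q.2.1 z)

/-- The moves for the productions `A → (B f, c)`. -/
def pushMoves (zs : List (List ℕ)) (q : ℕ × ℕ × ℕ × List ℕ) : List (StackMove State ℕ Letter) :=
  zs.map fun z => (some (q.1, z), q.2.2.1, counterWord q.2.2.2, some (q.2.1, z))

/-- The moves for the productions `A f → (ν, c)`. -/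
def popMoves (b : Bool) (zs : List (List ℕ)) (q : ℕ × ℕ × List (ℕ ⊕ ℕ) × List ℕ) :
    List (StackMove State ℕ Letter) :=
  zs.map fun z => (some (q.1, sourceKey b q.2.2.1 z), q.2.1, outputWord q.2.2.1 q.2.2.2,
    targetState q.2.2.1 z)

/-- The words which the nonterminals may have to generate. -/
def keys (b : Bool) (w : List ℕ) : List (List ℕ) := bif b then words w w.length else [[]]

/-- The pushdown system which simulates a linear grammar. -/
def system (b : Bool) (w : List ℕ) (g : GrammarCode) : System State ℕ Letter :=
  (g.2.2.flatMap fun p => Sum.casesOn p (fun q => plainMoves b (keys b w) q) fun _ => [],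
    g.2.2.flatMap fun p => Sum.casesOn p (fun _ => []) fun p =>
      Sum.casesOn p (fun q => pushMoves (keys b w) q) fun _ => [],
    (g.2.2.flatMap fun p => Sum.casesOn p (fun _ => []) fun p =>
      Sum.casesOn p (fun _ => []) fun q => popMoves b (keys b w) q) ++
    -- When a block disappears, so do its remaining indices; the final state pops them so that runs
    -- end with the empty stack.
    (List.range g.1.2.2.1).map fun f => (none, f, [], none))

/-- The equality of all counters. -/
def counterEquations (k : ℕ) : List (Letter × Letter) :=
  (List.range k).map fun i => (Sum.inr 0, Sum.inr i)

/-- The outputs of the derivations in which all counters end up with equal values. -/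
def outputReps (b : Bool) (w : List ℕ) (g : GrammarCode) : List (LinRep Letter) :=
  restrictEqs (counterEquations g.1.2.2.2)
    (runReps (system b w g) (some (g.2.1, key b w)) none)

section Simulation

variable {V T I : Type*} {k v t m : ℕ} {eV : V ≃ Fin v} {eT : T ≃ Fin t} {eI : I ≃ Fin m}
  {G : CounterIndexedGrammar V T I k}

theorem mem_system_internal {b : Bool} {w : List ℕ} {a : InternalMove State Letter} :
    a ∈ (system b w (G.code eV eT eI)).1 ↔ ∃ A ν c, .plain A ν c ∈ G.productions ∧
      ∃ z ∈ keys b w, a = (some ((eV A : ℕ), sourceKey b (codeRhs eV eT ν) z),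
        outputWord (codeRhs eV eT ν) (List.ofFn c), targetState (codeRhs eV eT ν) z) := by
  simp only [system, code, List.mem_flatMap, List.mem_map]
  constructor
  · rintro ⟨_, ⟨p, hp, rfl⟩, h⟩
    cases p with
    | plain A ν c =>
      obtain ⟨z, hz, rfl⟩ := List.mem_map.1 h
      exact ⟨A, ν, c, hp, z, hz, rfl⟩
    | push A B f c => simp [CounterProduction.code] at h
    | pop A f ν c => simp [CounterProduction.code] at h
  · rintro ⟨A, ν, c, hp, z, hz, rfl⟩
    exact ⟨_, ⟨_, hp, rfl⟩, List.mem_map.2 ⟨z, hz, rfl⟩⟩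

theorem mem_system_push {b : Bool} {w : List ℕ} {a : StackMove State ℕ Letter} :
    a ∈ (system b w (G.code eV eT eI)).2.1 ↔ ∃ A B f c, .push A B f c ∈ G.productions ∧
      ∃ z ∈ keys b w, a = (some ((eV A : ℕ), z), (eI f : ℕ), counterWord (List.ofFn c),
        some ((eV B : ℕ), z)) := by
  simp only [system, code, List.mem_flatMap, List.mem_map]
  constructor
  · rintro ⟨_, ⟨p, hp, rfl⟩, h⟩
    cases p with
    | plain A ν c => simp [CounterProduction.code] at h
    | push A B f c =>
      obtain ⟨z, hz, rfl⟩ := List.mem_map.1 h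
      exact ⟨A, B, f, c, hp, z, hz, rfl⟩
    | pop A f ν c => simp [CounterProduction.code] at h
  · rintro ⟨A, B, f, c, hp, z, hz, rfl⟩
    exact ⟨_, ⟨_, hp, rfl⟩, List.mem_map.2 ⟨z, hz, rfl⟩⟩

theorem mem_system_pop {b : Bool} {w : List ℕ} {a : StackMove State ℕ Letter} :
    a ∈ (system b w (G.code eV eT eI)).2.2 ↔ (∃ A f ν c, .pop A f ν c ∈ G.productions ∧
      ∃ z ∈ keys b w, a = (some ((eV A : ℕ), sourceKey b (codeRhs eV eT ν) z), (eI f : ℕ),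
        outputWord (codeRhs eV eT ν) (List.ofFn c), targetState (codeRhs eV eT ν) z)) ∨
      ∃ f < m, a = (none, f, [], none) := by
  simp only [system, code, List.mem_append, List.mem_flatMap, List.mem_map, List.mem_range]
  refine or_congr ?_ ⟨?_, ?_⟩
  · constructor
    · rintro ⟨_, ⟨p, hp, rfl⟩, h⟩
      cases p with
      | plain A ν c => simp [CounterProduction.code] at h
      | push A B f c => simp [CounterProduction.code] at h
      | pop A f ν c =>
        obtain ⟨z, hz, rfl⟩ := List.mem_map.1 h
        exact ⟨A, f, ν, c, hp, z, hz, rfl⟩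
    · rintro ⟨A, f, ν, c, hp, z, hz, rfl⟩
      exact ⟨_, ⟨_, hp, rfl⟩, List.mem_map.2 ⟨z, hz, rfl⟩⟩
  · rintro ⟨f, hf, rfl⟩; exact ⟨f, hf, rfl⟩
  · rintro ⟨f, hf, rfl⟩; exact ⟨f, hf, rfl⟩

/-- The counter symbols with multiplicities `n`. -/
def counterMultiset (n : Fin k → ℕ) : Multiset Letter :=
  ∑ i, Multiset.replicate (n i) (Sum.inr (i : ℕ))

theorem counterMultiset_add (c n : Fin k → ℕ) :
    counterMultiset (c + n) = counterMultiset c + counterMultiset n := by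
  simp [counterMultiset, Multiset.replicate_add, Finset.sum_add_distrib]

theorem coe_flatMap {β γ : Type*} (l : List β) (f : β → List γ) :
    (l.flatMap f : Multiset γ) = (l.map fun x => (f x : Multiset γ)).sum := by
  induction l with
  | nil => rfl
  | cons x l ih => rw [List.flatMap_cons, ← Multiset.coe_add, ih, List.map_cons, List.sum_cons]

theorem coe_counterWord (c : Fin k → ℕ) :
    (counterWord (List.ofFn c) : Multiset Letter) = counterMultiset c := by
  rw [counterWord, coe_flatMap, counterMultiset, List.length_ofFn, ← List.sum_toFinset _
    List.nodup_range, List.toFinset_range, Finset.sum_range]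
  refine Finset.sum_congr rfl fun i _ => ?_
  simp [List.map_const', Multiset.coe_replicate]

/-- The output of a derivation of `w` with counter increments `n`. -/
def outputMultiset (eT : T ≃ Fin t) (w : List T) (n : Fin k → ℕ) : Multiset Letter :=
  ((codeWord eT w).map Sum.inl : List Letter) + counterMultiset n

theorem codeRhs_linearWord (u : List T) (o : Option V) (w : List T) :
    codeRhs eV eT (linearWord u o w) = (codeWord eT u).map Sum.inl ++
      o.toList.map (fun A => Sum.inr (eV A : ℕ)) ++ (codeWord eT w).map Sum.inl := by
  cases o <;> simp [codeRhs, linearWord, codeWord, Function.comp_def]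

theorem codeWord_append (u w : List T) :
    codeWord eT (u ++ w) = codeWord eT u ++ codeWord eT w := by simp [codeWord]

theorem targetState_linearWord (u : List T) (o : Option V) (w : List T) (z : List ℕ) :
    targetState (codeRhs eV eT (linearWord u o w)) z = o.map fun A => ((eV A : ℕ), z) := by
  cases o <;> simp [targetState, codeRhs_linearWord, List.filterMap_append, List.filterMap_map,
    Function.comp_def]

theorem outputWord_linearWord (u : List T) (o : Option V) (x w : List T) (c n : Fin k → ℕ) :
    (outputWord (codeRhs eV eT (linearWord u o x)) (List.ofFn c) : Multiset Letter) +
      outputMultiset eT w n = outputMultiset eT (u ++ w ++ x) (c + n) := by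
  have : (codeRhs eV eT (linearWord u o x)).filterMap Sum.getLeft? =
      codeWord eT u ++ codeWord eT x := by
    cases o <;> simp [codeRhs_linearWord, List.filterMap_append, List.filterMap_map,
      Function.comp_def, List.filterMap_cons]
  rw [outputWord, this, outputMultiset, outputMultiset, counterMultiset_add, ← coe_counterWord c,
    codeWord_append, codeWord_append]
  simp only [List.map_append, ← Multiset.coe_add]
  abel

theorem counterWord_add_outputMultiset (w : List T) (c n : Fin k → ℕ) :
    (counterWord (List.ofFn c) : Multiset Letter) + outputMultiset eT w n =
      outputMultiset eT w (c + n) := by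
  rw [coe_counterWord, outputMultiset, outputMultiset, counterMultiset_add]
  abel

/-- Without a nonterminal on the right side, `z` does not enter the source key, so it is constrained
only when `o ≠ none`; in the other case the inner word is empty. -/
theorem sourceKey_linearWord (b : Bool) (u : List T) (o : Option V) (x w : List T) (z : List ℕ)
    (ho : o = none → w = []) (hz : o ≠ none → z = key b (codeWord eT w)) :
    sourceKey b (codeRhs eV eT (linearWord u o x)) z = key b (codeWord eT (u ++ w ++ x)) := by
  cases b with
  | false => rfl
  | true =>
    simp only [sourceKey, key, cond_true] at hz ⊢
    cases o with
    | none =>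
      obtain rfl := ho rfl
      simp [codeRhs_linearWord, codeWord, List.flatMap_map, Function.comp_def,
        ← List.map_eq_flatMap]
    | some B =>
      obtain rfl := hz (by simp)
      simp [codeRhs_linearWord, codeWord, List.flatMap_map, Function.comp_def,
        ← List.map_eq_flatMap]

/-- Blocks occurring later generate sublists of `w`. Closing `hw` under sublists makes all their
keys available as guesses in the system. -/
theorem Generates.run {b : Bool} {W : List ℕ} {o : Option V} {α : List I} {w : List T}
    {n : Fin k → ℕ} (h : G.Generates o α w n)
    (hw : ∀ w', w'.Sublist w → key b (codeWord eT w') ∈ keys b W) :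
    Run (system b W (G.code eV eT eI)) none [] (o.map fun A => ((eV A : ℕ), key b (codeWord eT w)))
      (α.map fun f => (eI f : ℕ)) (outputMultiset eT w n) := by
  induction h with
  | done α =>
    have : outputMultiset (k := k) eT ([] : List T) 0 = 0 := by
      simp [outputMultiset, counterMultiset, codeWord]
    rw [this]
    induction α with
    | nil => exact .refl
    | cons f α ih =>
      have := Run.pop (mem_system_pop.2 (Or.inr ⟨eI f, (eI f).2, rfl⟩)) ih
      simpa using this
  | @plain A u o x c α w n hp hg ih =>
    have hsub : w.Sublist (u ++ w ++ x) := by simp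
    have := Run.internal (mem_system_internal.2 ⟨A, _, c, hp, key b (codeWord eT w),
      hw w hsub, rfl⟩) (by
        rw [targetState_linearWord]
        exact ih fun w' hw' => hw w' (hw'.trans hsub))
    rwa [sourceKey_linearWord b u o x w _ (fun ho => (hg.eq_nil ho).1) fun _ => rfl,
      outputWord_linearWord] at this
  | @push A B f c α w n hp hg ih =>
    have := Run.push (mem_system_push.2 ⟨A, B, f, c, hp, key b (codeWord eT w),
      hw w (List.Sublist.refl w), rfl⟩) (ih hw)
    rwa [counterWord_add_outputMultiset] at this
  | @pop A f u o x c α w n hp hg ih =>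
    have hsub : w.Sublist (u ++ w ++ x) := by simp
    have := Run.pop (mem_system_pop.2 (Or.inl ⟨A, f, _, c, hp, key b (codeWord eT w),
      hw w hsub, rfl⟩)) (by
        rw [targetState_linearWord]
        exact ih fun w' hw' => hw w' (hw'.trans hsub))
    rwa [sourceKey_linearWord b u o x w _ (fun ho => (hg.eq_nil ho).1) fun _ => rfl,
      outputWord_linearWord] at this

/-- The numberings are injective, so each move of the system determines the production it comes
from. In the final state no key is present, hence the condition `o ≠ none`. -/
theorem IsLinear.generates_of_run (hG : G.IsLinear) {b : Bool} {W : List ℕ} {s : State}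
    {γ : List ℕ} {x : Multiset Letter}
    (h : Run (system b W (G.code eV eT eI)) none [] s γ x) {o : Option V} {z : List ℕ}
    {α : List I} (hs : s = o.map fun A => ((eV A : ℕ), z)) (hγ : γ = α.map fun f => (eI f : ℕ)) :
    ∃ w n, G.Generates o α w n ∧ x = outputMultiset eT w n ∧
      (o ≠ none → z = key b (codeWord eT w)) := by
  have hV : ∀ {o : Option V} {A : V} {z z' : List ℕ}, some ((eV A : ℕ), z') =
      o.map (fun A => ((eV A : ℕ), z)) → o = some A ∧ z' = z := by
    intro o A z z' h
    cases o with
    | none => simp at h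
    | some B =>
      simp only [Option.map_some, Option.some.injEq, Prod.mk.injEq] at h
      exact ⟨by rw [eV.injective (Fin.ext h.1)], h.2⟩
  have hI : ∀ {f : I} {γ : List ℕ} {α : List I}, (eI f : ℕ) :: γ = α.map (fun f => (eI f : ℕ)) →
      ∃ α', α = f :: α' ∧ γ = α'.map fun f => (eI f : ℕ) := by
    intro f γ α h
    cases α with
    | nil => simp at h
    | cons f' α =>
      simp only [List.map_cons, List.cons.injEq] at h
      exact ⟨α, by rw [eI.injective (Fin.ext h.1)], h.2⟩
  induction h generalizing o z α with
  | refl =>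
    cases o with
    | some A => simp at hs
    | none =>
      refine ⟨[], 0, .done α, ?_, by simp⟩
      simp [outputMultiset, counterMultiset, codeWord]
  | internal hm _ ih =>
    obtain ⟨A, ν, c, hp, z', -, heq⟩ := mem_system_internal.1 hm
    obtain ⟨u, o', y, rfl⟩ := exists_eq_linearWord (hG _ hp)
    simp only [Prod.mk.injEq] at heq
    obtain ⟨rfl, rfl, rfl⟩ := heq
    obtain ⟨rfl, rfl⟩ := hV hs
    obtain ⟨w, n, hw, rfl, hz⟩ := ih (targetState_linearWord _ _ _ _) hγ
    exact ⟨u ++ w ++ y, c + n, .plain hp hw, outputWord_linearWord _ _ _ _ _ _,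
      fun _ => sourceKey_linearWord b u o' y w z' (fun ho => (hw.eq_nil ho).1) hz⟩
  | push hm _ ih =>
    obtain ⟨A, B, f, c, hp, z', -, heq⟩ := mem_system_push.1 hm
    simp only [Prod.mk.injEq] at heq
    obtain ⟨rfl, rfl, rfl, rfl⟩ := heq
    obtain ⟨rfl, rfl⟩ := hV hs
    obtain ⟨w, n, hw, rfl, hz⟩ := ih (o := some B) (z := z') (α := f :: α) rfl (by simp [hγ])
    refine ⟨w, c + n, .push hp hw, ?_, fun _ => hz (by simp)⟩
    rw [counterWord_add_outputMultiset]
  | pop hm _ ih =>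
    rcases mem_system_pop.1 hm with ⟨A, f, ν, c, hp, z', -, heq⟩ | ⟨f, hf, heq⟩
    · obtain ⟨u, o', y, rfl⟩ := exists_eq_linearWord (hG _ hp)
      simp only [Prod.mk.injEq] at heq
      obtain ⟨rfl, rfl, rfl, rfl⟩ := heq
      obtain ⟨rfl, rfl⟩ := hV hs
      obtain ⟨α', rfl, hγ'⟩ := hI hγ
      obtain ⟨w, n, hw, rfl, hz⟩ := ih (targetState_linearWord _ _ _ _) hγ'
      exact ⟨u ++ w ++ y, c + n, .pop hp hw, outputWord_linearWord _ _ _ _ _ _,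
        fun _ => sourceKey_linearWord b u o' y w z' (fun ho => (hw.eq_nil ho).1) hz⟩
    -- A pop in the final state only discards an index and corresponds to no production.
    · simp only [Prod.mk.injEq] at heq
      obtain ⟨rfl, rfl, rfl, rfl⟩ := heq
      cases o with
      | some A => simp at hs
      | none =>
        cases α with
        | nil => simp at hγ
        | cons f' α =>
          simp only [List.map_cons, List.cons.injEq] at hγ
          obtain ⟨w, n, hw, rfl, -⟩ := ih (o := none) (z := z) (α := α) rfl hγ.2
          obtain ⟨rfl, rfl⟩ := hw.eq_nil rfl
          exact ⟨[], 0, .done _, by simp, by simp⟩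

theorem count_outputMultiset_inr (w : List T) (n : Fin k → ℕ) (i : Fin k) :
    (outputMultiset eT w n).count (Sum.inr (i : ℕ)) = n i := by
  have h1 : (((codeWord eT w).map Sum.inl : List Letter) : Multiset Letter).count
      (Sum.inr (i : ℕ)) = 0 := Multiset.count_eq_zero.2 (by simp)
  rw [outputMultiset, Multiset.count_add, h1, counterMultiset, Multiset.count_sum', zero_add]
  simp [Multiset.count_replicate, Fin.val_inj]

theorem counters_eq_iff (w : List T) (n : Fin k → ℕ) :
    (∀ e ∈ counterEquations k, (outputMultiset eT w n).count e.1 =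
      (outputMultiset eT w n).count e.2) ↔ ∀ i j, n i = n j := by
  simp only [counterEquations, List.mem_map, List.mem_range, forall_exists_index, and_imp,
    forall_apply_eq_imp_iff₂]
  constructor
  · intro h i j
    rw [← count_outputMultiset_inr (eT := eT) w n i, ← count_outputMultiset_inr (eT := eT) w n j,
      ← h i i.2, ← h j j.2]
  · intro h i hi
    have := h ⟨0, by omega⟩ ⟨i, hi⟩
    rwa [← count_outputMultiset_inr (eT := eT) w n, ← count_outputMultiset_inr (eT := eT) w n]
      at this

/-- The outputs are exactly those of the derivations of words of the language. -/
theorem IsLinear.mem_semiSet_outputReps (hG : G.IsLinear) {b : Bool} {w₀ : List T}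
    {x : Multiset Letter} :
    x ∈ semiSet (outputReps b (codeWord eT w₀) (G.code eV eT eI)) ↔
      ∃ w n, G.Generates (some G.start) [] w n ∧ (∀ i j, n i = n j) ∧
        key b (codeWord eT w₀) = key b (codeWord eT w) ∧ x = outputMultiset eT w n := by
  rw [outputReps, semiSet_restrictEqs, Set.mem_ofPred_eq, mem_semiSet_runReps]
  constructor
  · rintro ⟨h, hc⟩
    obtain ⟨w, n, hw, rfl, hz⟩ := hG.generates_of_run h (o := some G.start) (α := []) rfl rfl
    exact ⟨w, n, hw, (counters_eq_iff w n).1 hc, hz (by simp), rfl⟩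
  · rintro ⟨w, n, hw, hn, hkey, rfl⟩
    refine ⟨?_, (counters_eq_iff w n).2 hn⟩
    have := hw.run (b := b) (W := codeWord eT w₀) (eV := eV) (eT := eT) (eI := eI) ?_
    · rw [← hkey] at this
      exact this
    · intro w' hw'
      cases b with
      | false => simp [key, keys]
      | true =>
        simp only [key, keys, cond_true] at hkey ⊢
        have hsub : (codeWord eT w').Sublist (codeWord eT w₀) := hkey ▸ hw'.map _
        exact mem_words.2 ⟨hsub.length_le, fun a ha => hsub.subset ha⟩

/-- With `b = true` the initial key forces the generated word to be `w`. A linear set contains its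
constant, so a nonempty list of representations already yields a derivation. -/
theorem IsLinear.mem_language_iff_outputReps (hG : G.IsLinear) (w : List T) :
    w ∈ G.language ↔ outputReps true (codeWord eT w) (G.code eV eT eI) ≠ [] := by
  rw [hG.mem_language_iff]
  constructor
  · rintro ⟨n, hw, hn⟩ hnil
    have := (hG.mem_semiSet_outputReps (eV := eV) (eT := eT) (eI := eI)
      (b := true) (w₀ := w) (x := outputMultiset eT w n)).2 ⟨w, n, hw, hn, rfl, rfl⟩
    rw [hnil] at this
    obtain ⟨p, hp, -⟩ := this
    simp at hp
  · intro h
    obtain ⟨p, hp⟩ := List.exists_mem_of_ne_nil _ h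
    obtain ⟨w', n, hw, hn, hkey, -⟩ := hG.mem_semiSet_outputReps.1
      (⟨p, hp, [], by simp, rfl⟩ :
        ((p.1 ++ ([] : List (List Letter)).flatten : List Letter) : Multiset Letter) ∈
        semiSet (outputReps true (codeWord eT w) (G.code eV eT eI)))
    have : w = w' := by
      have hinj : Function.Injective fun a : T => (eT a : ℕ) :=
        fun a b h => eT.injective (Fin.ext h)
      exact hinj.list_map hkey
    exact ⟨n, this ▸ hw, hn⟩

end Simulation

end CounterIndexedGrammar

/-! ### Primitive recursiveness of the constructions -/

section Primrec

open SemilinearWords CommutativeGrammar PushdownSystem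

variable {γ β α N Q I : Type*} [Primcodable γ] [Primcodable β] [Primcodable α] [Primcodable N]
  [Primcodable Q] [Primcodable I]

theorem Primrec.list_count [DecidableEq α] : Primrec₂ fun (a : α) (l : List α) => l.count a := by
  -- Counting is the length of a filtered list, and filtering is a `flatMap` into lists with at most
  -- one member.
  have h : Primrec₂ fun (a : α) (l : List α) =>
      (l.flatMap fun b => bif b == a then [b] else []).length :=
    Primrec.list_length.comp (Primrec.list_flatMap Primrec.snd
      (Primrec.cond (Primrec.beq.comp Primrec.snd (Primrec.fst.comp Primrec.fst))
        (Primrec.list_cons.comp Primrec.snd (Primrec.const [])) (Primrec.const [])))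
  refine h.of_eq fun a l => ?_
  induction l with
  | nil => rfl
  | cons b l ih =>
    rw [List.flatMap_cons, List.length_append, ih, List.count_cons]
    by_cases hb : b = a
    · simp [hb, add_comm]
    · simp [beq_eq_false_iff_ne.2 hb]

theorem Primrec.list_elem [DecidableEq α] : Primrec₂ fun (a : α) (l : List α) => l.elem a := by
  have h : Primrec₂ fun (a : α) (l : List α) => !(l.count a == 0) :=
    Primrec.not.comp (Primrec.beq.comp Primrec.list_count (Primrec.const 0))
  refine h.of_eq fun a l => ?_
  rw [Bool.eq_iff_iff]
  simp [List.count_eq_zero]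

theorem primrec_words : Primrec₂ fun (l : List β) (n : ℕ) => words l n := by
  -- The structural recursion is rewritten as an explicit `Nat.rec` with `l` as parameter.
  have h : Primrec₂ fun (l : List β) (n : ℕ) => Nat.rec (motive := fun _ => List (List β)) [[]]
      (fun _ S => [] :: S.flatMap fun w => l.map fun x => x :: w) n := by
    have hstep : Primrec₂ fun (l : List β) (x : ℕ × List (List β)) =>
        [] :: x.2.flatMap fun w => l.map fun x => x :: w := by
      refine Primrec.list_cons.comp (Primrec.const [])
        (Primrec.list_flatMap (Primrec.snd.comp Primrec.snd) ?_)
      exact Primrec.list_map (Primrec.fst.comp Primrec.fst)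
        (Primrec.list_cons.comp Primrec.snd (Primrec.snd.comp Primrec.fst))
    exact Primrec.nat_rec (Primrec.const [[]]) hstep
  refine h.of_eq fun l n => ?_
  induction n with
  | zero => rfl
  | succ n ih => rw [words, ← ih]

theorem primrec_balanced [DecidableEq α] :
    Primrec₂ fun (e : α × α) (w : List α) => balanced e w :=
  Primrec.beq.comp (Primrec.list_count.comp (Primrec.fst.comp Primrec.fst) Primrec.snd)
    (Primrec.list_count.comp (Primrec.snd.comp Primrec.fst) Primrec.snd)

theorem primrec_lengthBound : Primrec fun p : LinRep α => lengthBound p :=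
  Primrec.nat_add.comp (Primrec.nat_mul.comp (Primrec.const 2) (Primrec.list_length.comp
    (Primrec.list_append.comp Primrec.fst (Primrec.list_flatten.comp Primrec.snd))))
    (Primrec.const 1)

theorem primrec_shortWords : Primrec fun p : LinRep α => words p.2 (lengthBound p) :=
  primrec_words.comp Primrec.snd primrec_lengthBound

theorem primrec_balancedPeriods [DecidableEq α] :
    Primrec₂ fun (e : α × α) (p : LinRep α) => balancedPeriods e p := by
  refine Primrec.list_flatMap (primrec_shortWords.comp Primrec.snd) ?_
  have hw : Primrec fun x : ((α × α) × LinRep α) × List (List α) => x.2.flatten :=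
    Primrec.list_flatten.comp Primrec.snd
  exact Primrec.cond (primrec_balanced.comp (Primrec.fst.comp Primrec.fst) hw)
    (Primrec.list_cons.comp hw (Primrec.const [])) (Primrec.const [])

theorem primrec_restrictEq [DecidableEq α] :
    Primrec₂ fun (e : α × α) (p : LinRep α) => restrictEq e p := by
  refine Primrec.list_flatMap (primrec_shortWords.comp Primrec.snd) ?_
  have hw : Primrec fun x : ((α × α) × LinRep α) × List (List α) => x.1.2.1 ++ x.2.flatten :=
    Primrec.list_append.comp (Primrec.fst.comp (Primrec.snd.comp Primrec.fst))
      (Primrec.list_flatten.comp Primrec.snd)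
  exact Primrec.cond (primrec_balanced.comp (Primrec.fst.comp Primrec.fst) hw)
    (Primrec.list_cons.comp (Primrec.pair hw (primrec_balancedPeriods.comp
      (Primrec.fst.comp Primrec.fst) (Primrec.snd.comp Primrec.fst))) (Primrec.const []))
    (Primrec.const [])

theorem primrec_restrictEqs [DecidableEq α] :
    Primrec₂ fun (es : List (α × α)) (S : List (LinRep α)) => restrictEqs es S :=
  Primrec.list_foldl Primrec.fst Primrec.snd
    (Primrec.list_flatMap (Primrec.fst.comp Primrec.snd) (primrec_restrictEq.comp
      (Primrec.snd.comp (Primrec.snd.comp Primrec.fst)) Primrec.snd).to₂).to₂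

theorem primrec_project {f : α → Option β} (hf : Primrec f) :
    Primrec fun p : LinRep α => project f p := by
  have h : Primrec fun w : List α => w.filterMap f :=
    Primrec.listFilterMap Primrec.id (hf.comp Primrec.snd)
  exact Primrec.pair (h.comp Primrec.fst) (Primrec.list_map Primrec.snd (h.comp Primrec.snd))

theorem primrec_connectedLists [DecidableEq N] :
    Primrec₂ fun (p : N × List (Rule N α)) (n : ℕ) => connectedLists p.1 p.2 n := by
  have h : Primrec₂ fun (p : N × List (Rule N α)) (n : ℕ) =>
      Nat.rec (motive := fun _ => List (List (Rule N α))) [[]] (fun _ S => [] :: S.flatMap fun l =>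
        p.2.flatMap fun r =>
          bif (p.1 :: l.flatMap fun s => s.2.2).elem r.1 then [r :: l] else []) n := by
    have hstep : Primrec₂ fun (p : N × List (Rule N α)) (x : ℕ × List (List (Rule N α))) =>
        [] :: x.2.flatMap fun l => p.2.flatMap fun r =>
          bif (p.1 :: l.flatMap fun s => s.2.2).elem r.1 then [r :: l] else [] := by
      refine Primrec.list_cons.comp (Primrec.const [])
        (Primrec.list_flatMap (Primrec.snd.comp Primrec.snd) ?_)
      refine Primrec.list_flatMap (Primrec.snd.comp (Primrec.fst.comp Primrec.fst)) ?_
      refine Primrec.cond (Primrec.list_elem.comp (Primrec.fst.comp Primrec.snd)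
        (Primrec.list_cons.comp
          (Primrec.fst.comp (Primrec.fst.comp (Primrec.fst.comp Primrec.fst)))
          (Primrec.list_flatMap (Primrec.snd.comp Primrec.fst)
            (Primrec.snd.comp (Primrec.snd.comp Primrec.snd)))))
        (Primrec.list_cons.comp (Primrec.list_cons.comp Primrec.snd (Primrec.snd.comp Primrec.fst))
          (Primrec.const [])) (Primrec.const [])
    exact Primrec.nat_rec (Primrec.const [[]]) hstep
  refine h.of_eq fun p n => ?_
  induction n with
  | zero => rfl
  | succ n ih => rw [connectedLists, ← ih]

theorem primrec_ruleWord : Primrec fun r : Rule N α => ruleWord r :=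
  Primrec.list_append.comp
    (Primrec.list_map (Primrec.fst.comp Primrec.snd) (Primrec.sumInl.comp Primrec.snd))
    (Primrec.list_cons.comp (Primrec.sumInr.comp (Primrec.sumInr.comp Primrec.fst))
      (Primrec.list_map (Primrec.snd.comp Primrec.snd)
        (Primrec.sumInr.comp (Primrec.sumInl.comp Primrec.snd))))

theorem primrec_connectedReps [DecidableEq N] :
    Primrec₂ fun (X : N) (rules : List (Rule N α)) => connectedReps X rules := by
  refine Primrec.list_map (primrec_connectedLists.comp Primrec.id
    (Primrec.list_length.comp Primrec.snd)) (Primrec.pair (Primrec.list_cons.comp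
      (Primrec.sumInr.comp (Primrec.sumInl.comp (Primrec.fst.comp Primrec.fst))) ?_) ?_)
  · exact Primrec.list_flatMap Primrec.snd (primrec_ruleWord.comp Primrec.snd)
  · exact Primrec.list_map Primrec.snd (primrec_ruleWord.comp Primrec.snd)

theorem primrec_balanceEquations :
    Primrec₂ fun (X : N) (rules : List (Rule N α)) => balanceEquations X rules := by
  refine Primrec.list_map (Primrec.list_cons.comp Primrec.fst (Primrec.list_flatMap Primrec.snd ?_))
    (Primrec.pair (Primrec.sumInr.comp (Primrec.sumInl.comp Primrec.snd))
      (Primrec.sumInr.comp (Primrec.sumInr.comp Primrec.snd)))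
  exact Primrec.list_cons.comp (Primrec.fst.comp Primrec.snd)
    (Primrec.snd.comp (Primrec.snd.comp Primrec.snd))

theorem primrec_getLeft? : Primrec fun s : α ⊕ β => s.getLeft? :=
  (Primrec.sumCasesOn Primrec.id (Primrec.option_some.comp Primrec.snd).to₂
    (Primrec.const none).to₂).of_eq fun s => by cases s <;> rfl

theorem primrec_getRight? : Primrec fun s : α ⊕ β => s.getRight? :=
  (Primrec.sumCasesOn Primrec.id (Primrec.const none).to₂
    (Primrec.option_some.comp Primrec.snd).to₂).of_eq fun s => by cases s <;> rfl

theorem primrec_parikhReps [DecidableEq N] [DecidableEq α] :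
    Primrec₂ fun (X : N) (rules : List (Rule N α)) => parikhReps X rules :=
  Primrec.list_map (primrec_restrictEqs.comp primrec_balanceEquations primrec_connectedReps)
    ((primrec_project primrec_getLeft?).comp Primrec.snd)

theorem primrec_endStates :
    Primrec₂ fun (D : System Q I α) (r : Q) => endStates D r :=
  Primrec.list_cons.comp Primrec.snd (Primrec.list_map
    (Primrec.snd.comp (Primrec.snd.comp Primrec.fst)) (Primrec.fst.comp Primrec.snd))

theorem primrec_matchedRules [DecidableEq I] :
    Primrec₂ fun (D : System Q I α) (r : Q) => matchedRules D r := by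
  refine Primrec.list_append.comp (Primrec.list_append.comp ?_ ?_) ?_
  · exact Primrec.list_map primrec_endStates
      (Primrec.pair (Primrec.pair Primrec.snd Primrec.snd) (Primrec.const ([], [])))
  · refine Primrec.list_flatMap (Primrec.fst.comp Primrec.fst)
      (Primrec.list_map (primrec_endStates.comp (Primrec.fst.comp Primrec.fst)
        (Primrec.snd.comp Primrec.fst)) ?_)
    have ha : Primrec fun x : ((System Q I α × Q) × InternalMove Q α) × Q => x.1.2 :=
      Primrec.snd.comp Primrec.fst
    exact Primrec.pair (Primrec.pair (Primrec.fst.comp ha) Primrec.snd)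
      (Primrec.pair (Primrec.fst.comp (Primrec.snd.comp ha)) (Primrec.list_cons.comp
        (Primrec.pair (Primrec.snd.comp (Primrec.snd.comp ha)) Primrec.snd) (Primrec.const [])))
  · refine Primrec.list_flatMap (Primrec.fst.comp (Primrec.snd.comp Primrec.fst))
      (Primrec.list_flatMap (Primrec.snd.comp (Primrec.snd.comp (Primrec.fst.comp Primrec.fst)))
        (Primrec.cond ?_ (Primrec.list_map
          (primrec_endStates.comp (Primrec.fst.comp (Primrec.fst.comp Primrec.fst))
            (Primrec.snd.comp (Primrec.fst.comp Primrec.fst))) ?_) (Primrec.const [])))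
    · exact Primrec.beq.comp (Primrec.fst.comp (Primrec.snd.comp (Primrec.snd.comp Primrec.fst)))
        (Primrec.fst.comp (Primrec.snd.comp Primrec.snd))
    · have ha : Primrec fun x : (((System Q I α × Q) × StackMove Q I α) × StackMove Q I α) × Q =>
          x.1.1.2 := Primrec.snd.comp (Primrec.fst.comp Primrec.fst)
      have hb : Primrec fun x : (((System Q I α × Q) × StackMove Q I α) × StackMove Q I α) × Q =>
          x.1.2 := Primrec.snd.comp Primrec.fst
      have hs : Primrec fun x : (((System Q I α × Q) × StackMove Q I α) × StackMove Q I α) × Q =>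
          x.2 := Primrec.snd
      refine Primrec.pair (Primrec.pair (Primrec.fst.comp ha) hs) (Primrec.pair
        (Primrec.list_append.comp
          (Primrec.fst.comp (Primrec.snd.comp (Primrec.snd.comp ha)))
          (Primrec.fst.comp (Primrec.snd.comp (Primrec.snd.comp hb))))
        (Primrec.list_cons.comp (Primrec.pair
          (Primrec.snd.comp (Primrec.snd.comp (Primrec.snd.comp ha))) (Primrec.fst.comp hb))
          (Primrec.list_cons.comp (Primrec.pair
            (Primrec.snd.comp (Primrec.snd.comp (Primrec.snd.comp hb))) hs) (Primrec.const []))))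

theorem primrec_runReps [DecidableEq Q] [DecidableEq I] [DecidableEq α]
    {f : γ → System Q I α} {p r : γ → Q} (hf : Primrec f) (hp : Primrec p) (hr : Primrec r) :
    Primrec fun x => runReps (f x) (p x) (r x) :=
  primrec_parikhReps.comp (Primrec.pair hp hr) (primrec_matchedRules.comp hf hr)

end Primrec

/-! ### Primitive recursiveness of the translation from grammars to pushdown systems. -/

namespace CounterIndexedGrammar

open SemilinearWords PushdownSystem

theorem primrec_counterWord : Primrec fun c : List ℕ => counterWord c := by
  refine Primrec.list_flatMap (Primrec.list_range.comp Primrec.list_length) ?_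
  exact Primrec.list_map (Primrec.list_range.comp (Primrec.list_getD 0))
    (Primrec.sumInr.comp (Primrec.snd.comp Primrec.fst))

theorem primrec_outputWord :
    Primrec₂ fun (ν : List (ℕ ⊕ ℕ)) (c : List ℕ) => outputWord ν c :=
  Primrec.list_append.comp (Primrec.list_map
    (Primrec.listFilterMap Primrec.fst (primrec_getLeft?.comp Primrec.snd))
    (Primrec.sumInl.comp Primrec.snd)) (primrec_counterWord.comp Primrec.snd)

theorem primrec_targetState :
    Primrec₂ fun (ν : List (ℕ ⊕ ℕ)) (z : List ℕ) => targetState ν z :=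
  Primrec.option_map (Primrec.list_head?.comp
    (Primrec.listFilterMap Primrec.fst (primrec_getRight?.comp Primrec.snd)))
    (Primrec.pair Primrec.snd (Primrec.snd.comp Primrec.fst))

theorem primrec_key (b : Bool) : Primrec fun w : List ℕ => key b w :=
  Primrec.cond (Primrec.const b) Primrec.id (Primrec.const [])

theorem primrec_sourceKey (b : Bool) :
    Primrec₂ fun (ν : List (ℕ ⊕ ℕ)) (z : List ℕ) => sourceKey b ν z :=
  (primrec_key b).comp (Primrec.list_flatMap Primrec.fst (Primrec.sumCasesOn Primrec.snd
    (Primrec.list_cons.comp Primrec.snd (Primrec.const []))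
    (Primrec.snd.comp (Primrec.fst.comp Primrec.fst))))

theorem primrec_plainMoves (b : Bool) :
    Primrec₂ fun (zs : List (List ℕ)) (q : ℕ × List (ℕ ⊕ ℕ) × List ℕ) => plainMoves b zs q := by
  refine Primrec.list_map Primrec.fst ?_
  have hq : Primrec fun x : (List (List ℕ) × ℕ × List (ℕ ⊕ ℕ) × List ℕ) × List ℕ => x.1.2 :=
    Primrec.snd.comp Primrec.fst
  have hν := Primrec.fst.comp (Primrec.snd.comp hq)
  exact Primrec.pair (Primrec.option_some.comp (Primrec.pair (Primrec.fst.comp hq)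
      ((primrec_sourceKey b).comp hν Primrec.snd)))
    (Primrec.pair (primrec_outputWord.comp hν (Primrec.snd.comp (Primrec.snd.comp hq)))
      (primrec_targetState.comp hν Primrec.snd))

theorem primrec_pushMoves :
    Primrec₂ fun (zs : List (List ℕ)) (q : ℕ × ℕ × ℕ × List ℕ) => pushMoves zs q := by
  refine Primrec.list_map Primrec.fst ?_
  have hq : Primrec fun x : (List (List ℕ) × ℕ × ℕ × ℕ × List ℕ) × List ℕ => x.1.2 :=
    Primrec.snd.comp Primrec.fst
  have hr := Primrec.snd.comp hq
  exact Primrec.pair (Primrec.option_some.comp (Primrec.pair (Primrec.fst.comp hq) Primrec.snd))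
    (Primrec.pair (Primrec.fst.comp (Primrec.snd.comp hr))
      (Primrec.pair (primrec_counterWord.comp (Primrec.snd.comp (Primrec.snd.comp hr)))
        (Primrec.option_some.comp (Primrec.pair (Primrec.fst.comp hr) Primrec.snd))))

theorem primrec_popMoves (b : Bool) :
    Primrec₂ fun (zs : List (List ℕ)) (q : ℕ × ℕ × List (ℕ ⊕ ℕ) × List ℕ) => popMoves b zs q := by
  refine Primrec.list_map Primrec.fst ?_
  have hq : Primrec fun x : (List (List ℕ) × ℕ × ℕ × List (ℕ ⊕ ℕ) × List ℕ) × List ℕ => x.1.2 :=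
    Primrec.snd.comp Primrec.fst
  have hr := Primrec.snd.comp (Primrec.snd.comp hq)
  have hν := Primrec.fst.comp hr
  exact Primrec.pair (Primrec.option_some.comp (Primrec.pair (Primrec.fst.comp hq)
      ((primrec_sourceKey b).comp hν Primrec.snd)))
    (Primrec.pair (Primrec.fst.comp (Primrec.snd.comp hq))
      (Primrec.pair (primrec_outputWord.comp hν (Primrec.snd.comp hr))
        (primrec_targetState.comp hν Primrec.snd)))

theorem primrec_keys (b : Bool) : Primrec fun w : List ℕ => keys b w :=
  Primrec.cond (Primrec.const b) (primrec_words.comp Primrec.id Primrec.list_length)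
    (Primrec.const [[]])

theorem primrec_counterEquations : Primrec counterEquations :=
  Primrec.list_map Primrec.list_range
    (Primrec.pair (Primrec.const (Sum.inr 0)) (Primrec.sumInr.comp Primrec.snd))

section

variable {γ : Type*} [Primcodable γ] {g : γ → GrammarCode} {w : γ → List ℕ}

theorem primrec_system (b : Bool) (hg : Primrec g) (hw : Primrec w) :
    Primrec fun x => system b (w x) (g x) := by
  have hp : Primrec fun x => (g x).2.2 := Primrec.snd.comp (Primrec.snd.comp hg)
  have hm : Primrec fun x => (g x).1.2.2.1 :=
    Primrec.fst.comp (Primrec.snd.comp (Primrec.snd.comp (Primrec.fst.comp hg)))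
  have hz : Primrec fun x => keys b (w x) := (primrec_keys b).comp hw
  refine Primrec.pair ?_ (Primrec.pair ?_ (Primrec.list_append.comp ?_ ?_))
  · exact Primrec.list_flatMap hp (Primrec.sumCasesOn Primrec.snd
      ((primrec_plainMoves b).comp (hz.comp (Primrec.fst.comp Primrec.fst)) Primrec.snd)
      (Primrec.const []))
  · exact Primrec.list_flatMap hp (Primrec.sumCasesOn Primrec.snd (Primrec.const [])
      (Primrec.sumCasesOn Primrec.snd (primrec_pushMoves.comp
        (hz.comp (Primrec.fst.comp (Primrec.fst.comp Primrec.fst))) Primrec.snd)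
        (Primrec.const [])))
  · exact Primrec.list_flatMap hp (Primrec.sumCasesOn Primrec.snd (Primrec.const [])
      (Primrec.sumCasesOn Primrec.snd (Primrec.const []) ((primrec_popMoves b).comp
        (hz.comp (Primrec.fst.comp (Primrec.fst.comp Primrec.fst))) Primrec.snd)))
  · exact Primrec.list_map (Primrec.list_range.comp hm) (Primrec.pair (Primrec.const none)
      (Primrec.pair Primrec.snd (Primrec.const ([], none))))

theorem primrec_outputReps (b : Bool) (hg : Primrec g) (hw : Primrec w) :
    Primrec fun x => outputReps b (w x) (g x) := by
  have hstart : Primrec fun x => (some ((g x).2.1, key b (w x)) : State) :=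
    Primrec.option_some.comp (Primrec.pair (Primrec.fst.comp (Primrec.snd.comp hg))
      ((primrec_key b).comp hw))
  have hrun : Primrec fun x =>
      runReps (system b (w x) (g x)) (some ((g x).2.1, key b (w x))) none :=
    primrec_runReps (primrec_system b hg hw) hstart (Primrec.const none)
  have heqs : Primrec fun x => counterEquations (g x).1.2.2.2 :=
    primrec_counterEquations.comp
      (Primrec.snd.comp (Primrec.snd.comp (Primrec.snd.comp (Primrec.fst.comp hg))))
  exact primrec_restrictEqs.comp heqs hrun

end

end CounterIndexedGrammar

/-! ### Emptiness and infiniteness of represented semilinear sets. -/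

namespace SemilinearRep

variable {t : ℕ}

/-- Coefficient sums over the periods form the additive submonoid they generate. This connects the
representation with `IsLinearSet` and avoids handling coefficients. -/
theorem mem_toSet_iff {S : SemilinearRep t} {x : Fin t → ℕ} :
    x ∈ S.toSet ↔ ∃ p ∈ S, ∃ y ∈ AddSubmonoid.closure {v | v ∈ p.2}, x = p.1 + y := by
  have key : ∀ (l : List (Fin t → ℕ)) (y : Fin t → ℕ), y ∈ AddSubmonoid.closure {v | v ∈ l} ↔
      ∃ c : Fin l.length → ℕ, ∑ j, c j • l.get j = y := by
    intro l y
    rw [← Submodule.mem_span_range_iff_exists_fun, Set.range_list_get,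
      ← Submodule.mem_toAddSubmonoid, Submodule.span_nat_eq_addSubmonoidClosure]
  simp only [toSet, Set.mem_ofPred_eq]
  constructor
  · rintro ⟨p, hp, c, rfl⟩
    exact ⟨p, hp, _, (key _ _).2 ⟨c, rfl⟩, rfl⟩
  · rintro ⟨p, hp, y, hy, rfl⟩
    obtain ⟨c, rfl⟩ := (key _ _).1 hy
    exact ⟨p, hp, c, rfl⟩

open Pointwise in
theorem isSemilinearSet_toSet (S : SemilinearRep t) : IsSemilinearSet S.toSet := by
  have : S.toSet = ⋃ p ∈ {p | p ∈ S},
      p.1 +ᵥ (AddSubmonoid.closure {v | v ∈ p.2} : Set (Fin t → ℕ)) := by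
    ext x
    simp only [mem_toSet_iff, Set.mem_iUnion, Set.mem_vadd_set, Set.mem_ofPred_eq, vadd_eq_add,
      SetLike.mem_coe, exists_prop]
    constructor
    · rintro ⟨p, hp, y, hy, rfl⟩; exact ⟨p, hp, y, hy, rfl⟩
    · rintro ⟨p, hp, y, hy, rfl⟩; exact ⟨p, hp, y, hy, rfl⟩
  rw [this]
  refine IsSemilinearSet.biUnion (List.finite_toSet S) fun p _ => ?_
  exact IsLinearSet.isSemilinearSet ⟨p.1, _, List.finite_toSet p.2, rfl⟩

theorem toSet_nonempty_iff {S : SemilinearRep t} : S.toSet.Nonempty ↔ S ≠ [] := by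
  constructor
  · rintro ⟨x, p, hp, -⟩ rfl
    simp at hp
  · intro h
    obtain ⟨p, hp⟩ := List.exists_mem_of_ne_nil _ h
    exact ⟨p.1, mem_toSet_iff.2 ⟨p, hp, 0, zero_mem _, by simp⟩⟩

/-- If all periods vanish, only the finitely many constants remain. A period with a nonzero
coordinate gives infinitely many points `p.1 + n • v`. -/
theorem infinite_toSet_iff {S : SemilinearRep t} :
    S.toSet.Infinite ↔ ∃ p ∈ S, ∃ v ∈ p.2, v ≠ 0 := by
  constructor
  · intro h
    by_contra! hzero
    refine h (((List.finite_toSet S).image fun p => p.1).subset ?_)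
    intro x hx
    obtain ⟨p, hp, y, hy, rfl⟩ := mem_toSet_iff.1 hx
    have hbot : AddSubmonoid.closure {v | v ∈ p.2} ≤ ⊥ :=
      (AddSubmonoid.closure_le).2 fun v hv => hzero p hp v hv
    obtain rfl : y = 0 := by simpa using hbot hy
    exact ⟨p, hp, by simp⟩
  · rintro ⟨p, hp, v, hv, hv0⟩
    obtain ⟨i, hi⟩ := Function.ne_iff.1 hv0
    refine Set.infinite_of_injective_forall_mem (f := fun n : ℕ => p.1 + n • v) ?_ fun n =>
      mem_toSet_iff.2 ⟨p, hp, n • v, nsmul_mem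
        (AddSubmonoid.subset_closure (show v ∈ {v | v ∈ p.2} from hv)) n, rfl⟩
    intro a b hab
    have := congrFun hab i
    simpa using Or.resolve_right (by simpa using this) hi

end SemilinearRep

/-! ### The Parikh image as the terminal part of the outputs. -/

namespace CounterIndexedGrammar

open SemilinearWords

/-- The numbers of occurrences of the terminals in an output. -/
def terminalCounts (t : ℕ) (w : List Letter) : List ℕ :=
  (List.range t).map fun i => (w : Multiset Letter).count (Sum.inl i)

/-- The code of the Parikh image of a linear grammar. -/
def parikhCode (g : GrammarCode) : SemilinearCode :=
  (outputReps false [] g).map fun p =>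
    (terminalCounts g.1.2.1 p.1, p.2.map (terminalCounts g.1.2.1))

/-- The nonzero entries of the periods. -/
def periodEntries (S : SemilinearCode) : List ℕ :=
  S.flatMap fun p => p.2.flatten.flatMap fun n => bif n == 0 then [] else [n]

theorem primrec_terminalCounts :
    Primrec₂ fun (t : ℕ) (w : List Letter) => terminalCounts t w := by
  have h : Primrec₂ fun (x : ℕ × List Letter) (i : ℕ) =>
      (x.2 : Multiset Letter).count (Sum.inl i) :=
    (Primrec.list_count.comp (Primrec.sumInl.comp Primrec.snd)
      (Primrec.snd.comp Primrec.fst)).to₂.of_eq fun _ _ => (Multiset.coe_count _ _).symm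
  exact Primrec.list_map (Primrec.list_range.comp Primrec.fst) h

theorem primrec_parikhCode : Primrec parikhCode := by
  have ht : Primrec fun x : GrammarCode × LinRep Letter => x.1.1.2.1 :=
    Primrec.fst.comp (Primrec.snd.comp (Primrec.fst.comp Primrec.fst))
  have hS : Primrec fun g : GrammarCode => outputReps false [] g :=
    primrec_outputReps false Primrec.id (Primrec.const [])
  refine Primrec.list_map hS (Primrec.pair
    (primrec_terminalCounts.comp ht (Primrec.fst.comp Primrec.snd))
    (Primrec.list_map (Primrec.snd.comp Primrec.snd) ?_))
  exact primrec_terminalCounts.comp (ht.comp Primrec.fst) Primrec.snd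

theorem primrec_periodEntries : Primrec periodEntries :=
  Primrec.list_flatMap Primrec.id (Primrec.list_flatMap
    (Primrec.list_flatten.comp (Primrec.snd.comp Primrec.snd))
    (Primrec.cond (Primrec.beq.comp Primrec.snd (Primrec.const 0)) (Primrec.const [])
      (Primrec.list_cons.comp Primrec.snd (Primrec.const []))))

variable {V T I : Type*} {k v t m : ℕ}

/-- The Parikh vector of the terminals of an output. -/
def terminalVector (t : ℕ) (w : List Letter) : Fin t → ℕ := fun i =>
  (w : Multiset Letter).count (Sum.inl (i : ℕ))

/-- The semilinear set of Parikh vectors of the outputs in `S`. -/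
def terminalRep (t : ℕ) (S : List (LinRep Letter)) : SemilinearRep t :=
  S.map fun p => (terminalVector t p.1, p.2.map (terminalVector t))

theorem ofFn_terminalVector (w : List Letter) :
    List.ofFn (terminalVector t w) = terminalCounts t w := by
  refine List.ext_getElem (by simp [terminalCounts]) fun i h1 h2 => ?_
  simp [terminalCounts, terminalVector]

theorem code_terminalRep (S : List (LinRep Letter)) :
    (terminalRep t S).code =
      S.map fun p => (terminalCounts t p.1, p.2.map (terminalCounts t)) := by
  simp [terminalRep, SemilinearRep.code, Function.comp_def, ofFn_terminalVector]

theorem terminalVector_append (w w' : List Letter) :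
    terminalVector t (w ++ w') = terminalVector t w + terminalVector t w' := by
  funext i
  simp only [terminalVector, ← Multiset.coe_add, Multiset.count_add, Pi.add_apply]

theorem terminalVector_flatten (w : List (List Letter)) :
    terminalVector t w.flatten = (w.map (terminalVector t)).sum := by
  induction w with
  | nil => funext i; simp [terminalVector]
  | cons u w ih => rw [List.flatten_cons, terminalVector_append, ih, List.map_cons, List.sum_cons]

/-- Counting terminals is additive under concatenation, so it maps constants to constants and
periods to periods. -/
theorem mem_toSet_terminalRep {S : List (LinRep Letter)} {y : Fin t → ℕ} :
    y ∈ (terminalRep t S).toSet ↔ ∃ x ∈ semiSet S, 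
      y = fun i : Fin t => x.count (Sum.inl (i : ℕ)) := by
  simp only [SemilinearRep.mem_toSet_iff, terminalRep, List.mem_map, semiSet, linSet,
    Set.mem_ofPred_eq]
  constructor
  · rintro ⟨_, ⟨p, hp, rfl⟩, y, hy, rfl⟩
    obtain ⟨l, hl, rfl⟩ := AddSubmonoid.exists_list_of_mem_closure hy
    simp only [List.mem_map, Set.mem_ofPred_eq] at hl
    obtain ⟨w, hw, rfl⟩ := CommutativeGrammar.exists_map_eq_of_forall hl
    refine ⟨_, ⟨p, hp, w, hw, rfl⟩, ?_⟩
    rw [← terminalVector_flatten, ← terminalVector_append]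
    rfl
  · rintro ⟨_, ⟨p, hp, w, hw, rfl⟩, rfl⟩
    refine ⟨_, ⟨p, hp, rfl⟩, terminalVector t w.flatten, ?_, ?_⟩
    · rw [terminalVector_flatten]
      refine list_sum_mem fun v hv => AddSubmonoid.subset_closure ?_
      obtain ⟨u, hu, rfl⟩ := List.mem_map.1 hv
      exact List.mem_map.2 ⟨u, hw u hu, rfl⟩
    · rw [← terminalVector_append]
      rfl

theorem count_outputMultiset_inl (eT : T ≃ Fin t) (w : List T) (n : Fin k → ℕ) (i : Fin t) :
    (outputMultiset eT w n).count (Sum.inl (i : ℕ)) = (w.map eT).count i := by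
  have h1 : (counterMultiset n).count (Sum.inl (i : ℕ)) = 0 := by
    refine Multiset.count_eq_zero.2 fun h => ?_
    obtain ⟨j, -, hj⟩ := Multiset.mem_sum.1 h
    simpa using Multiset.eq_of_mem_replicate hj
  rw [outputMultiset, Multiset.count_add, h1, add_zero, ← Multiset.map_coe,
    Multiset.count_map_eq_count' _ _ Sum.inl_injective]
  have h2 : codeWord eT w = (w.map eT).map Fin.val := by simp [codeWord]
  rw [h2, Multiset.coe_count, List.count_map_of_injective _ _ Fin.val_injective]

/-- With `b = false` all keys are empty and every word is admitted. The counter symbols have served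
their purpose in the equations and are now ignored. -/
theorem IsLinear.parikhImage_eq {G : CounterIndexedGrammar V T I k} (hG : G.IsLinear)
    (eV : V ≃ Fin v) (eT : T ≃ Fin t) (eI : I ≃ Fin m) :
    parikhImage eT G.language =
      (terminalRep t (outputReps false [] (G.code eV eT eI))).toSet := by
  have hmem := fun x => hG.mem_semiSet_outputReps (eV := eV) (eT := eT) (eI := eI) (b := false)
    (w₀ := []) (x := x)
  ext y
  rw [mem_toSet_terminalRep]
  constructor
  · rintro ⟨w, hw, rfl⟩
    obtain ⟨n, hgen, hn⟩ := hG.mem_language_iff.1 hw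
    refine ⟨_, (hmem _).2 ⟨w, n, hgen, hn, rfl, rfl⟩, ?_⟩
    funext i
    rw [count_outputMultiset_inl]
  · rintro ⟨x, hx, rfl⟩
    obtain ⟨w, n, hgen, hn, -, rfl⟩ := (hmem x).1 hx
    refine ⟨w, hG.mem_language_iff.2 ⟨n, hgen, hn⟩, ?_⟩
    funext i
    rw [count_outputMultiset_inl]

theorem parikhCode_code (G : CounterIndexedGrammar V T I k) (eV : V ≃ Fin v) (eT : T ≃ Fin t)
    (eI : I ≃ Fin m) : parikhCode (G.code eV eT eI) =
      (terminalRep t (outputReps false [] (G.code eV eT eI))).code := by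
  rw [code_terminalRep]
  rfl

theorem periodEntries_code_ne_nil {S : SemilinearRep t} :
    periodEntries S.code ≠ [] ↔ ∃ p ∈ S, ∃ v ∈ p.2, v ≠ 0 := by
  have hne : ∀ l : List ℕ, l ≠ [] ↔ ∃ n, n ∈ l := fun l =>
    ⟨List.exists_mem_of_ne_nil l, fun ⟨n, hn⟩ => List.ne_nil_of_mem hn⟩
  simp only [hne, periodEntries, SemilinearRep.code, List.mem_flatMap, List.mem_map,
    List.mem_flatten]
  constructor
  · rintro ⟨n, _, ⟨p, hp, rfl⟩, a, ⟨_, hu, ha⟩, hn⟩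
    obtain ⟨v, hv, rfl⟩ := List.mem_map.1 hu
    obtain ⟨i, rfl⟩ := (List.mem_ofFn' _ _).1 ha
    refine ⟨p, hp, v, hv, ?_⟩
    rintro rfl
    simp at hn
  · rintro ⟨p, hp, v, hv, hv0⟩
    obtain ⟨i, hi⟩ := Function.ne_iff.1 hv0
    have hi' : (v i == 0) = false := by simpa using hi
    exact ⟨v i, _, ⟨p, hp, rfl⟩, v i, ⟨_, List.mem_map.2 ⟨v, hv, rfl⟩,
      (List.mem_ofFn' _ _).2 ⟨i, rfl⟩⟩, by rw [hi']; simp⟩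

end CounterIndexedGrammar

/-- A language over a finite alphabet is infinite iff its Parikh image is. -/
theorem infinite_parikhImage_iff {T : Type*} {t : ℕ} (e : T ≃ Fin t) (L : Language T) :
    (parikhImage e L).Infinite ↔ {w : List T | w ∈ L}.Infinite := by
  have : Finite T := Finite.of_equiv _ e.symm
  set f : List T → Fin t → ℕ := fun w i => (w.map e).count i
  have himage : parikhImage e L = f '' {w | w ∈ L} := by
    ext x
    simp only [parikhImage, Set.mem_ofPred_eq, Set.mem_image]
    exact ⟨fun ⟨w, hw, h⟩ => ⟨w, hw, h.symm⟩, fun ⟨w, hw, h⟩ => ⟨w, hw, h.symm⟩⟩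
  rw [himage]
  refine ⟨fun h hL => h (hL.image f), fun h hfin => h ?_⟩
  refine (hfin.preimage' fun x _ => ?_).subset (Set.subset_preimage_image f _)
  -- The coordinates of a Parikh vector add up to the length of the word, so each fibre consists of
  -- words of one length over a finite alphabet.
  refine (List.finite_length_eq T (∑ i, x i)).subset ?_
  rintro w rfl
  have := Multiset.sum_count_eq_card (s := Finset.univ) (m := (w.map e : Multiset (Fin t)))
    (fun a _ => Finset.mem_univ a)
  simpa [f, eq_comm] using this

open CounterIndexedGrammar in
/-- Languages generated by linear indexed grammars with counters are effectively semilinear, and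
have decidable emptiness, membership and infiniteness problems. Each algorithm is a single
computable function, uniform in the grammar, the alphabets and the number of counters. -/
theorem mainTheorem9 :
    (∃ f : GrammarCode → SemilinearCode, Computable f ∧
      ∀ (V T I : Type) (v t m k : ℕ) (eV : V ≃ Fin v) (eT : T ≃ Fin t) (eI : I ≃ Fin m)
        (G : CounterIndexedGrammar V T I k), G.IsLinear →
        IsSemilinearSet (parikhImage eT G.language) ∧
        ∃ S : SemilinearRep t,
          f (G.code eV eT eI) = S.code ∧ parikhImage eT G.language = S.toSet) ∧
    (∃ d : GrammarCode → Bool, Computable d ∧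
      ∀ (V T I : Type) (v t m k : ℕ) (eV : V ≃ Fin v) (eT : T ≃ Fin t) (eI : I ≃ Fin m)
        (G : CounterIndexedGrammar V T I k), G.IsLinear →
        (d (G.code eV eT eI) = true ↔ ∀ w : List T, w ∉ G.language)) ∧
    (∃ d : GrammarCode × List ℕ → Bool, Computable d ∧
      ∀ (V T I : Type) (v t m k : ℕ) (eV : V ≃ Fin v) (eT : T ≃ Fin t) (eI : I ≃ Fin m)
        (G : CounterIndexedGrammar V T I k), G.IsLinear → ∀ w : List T,
        (d (G.code eV eT eI, codeWord eT w) = true ↔ w ∈ G.language)) ∧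
    (∃ d : GrammarCode → Bool, Computable d ∧
      ∀ (V T I : Type) (v t m k : ℕ) (eV : V ≃ Fin v) (eT : T ≃ Fin t) (eI : I ≃ Fin m)
        (G : CounterIndexedGrammar V T I k), G.IsLinear →
        (d (G.code eV eT eI) = true ↔ {w : List T | w ∈ G.language}.Infinite)) := by
  -- Emptiness tests whether the code of the Parikh image is the empty list, infiniteness looks for
  -- a nonzero entry in a period, and membership tests the keyed representation for emptiness.
  refine ⟨⟨parikhCode, primrec_parikhCode.to_comp, ?_⟩,
    ⟨fun g => (parikhCode g).length == 0, (Primrec.beq.comp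
      (Primrec.list_length.comp primrec_parikhCode) (Primrec.const 0)).to_comp, ?_⟩,
    ⟨fun x => !((outputReps true x.2 x.1).length == 0), (Primrec.not.comp (Primrec.beq.comp
      (Primrec.list_length.comp
      (primrec_outputReps true Primrec.fst Primrec.snd)) (Primrec.const 0))).to_comp, ?_⟩,
    ⟨fun g => !((periodEntries (parikhCode g)).length == 0), (Primrec.not.comp (Primrec.beq.comp
      (Primrec.list_length.comp (primrec_periodEntries.comp primrec_parikhCode))
      (Primrec.const 0))).to_comp, ?_⟩⟩
  · intro V T I v t m k eV eT eI G hG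
    have h := hG.parikhImage_eq eV eT eI
    exact ⟨h ▸ SemilinearRep.isSemilinearSet_toSet _, _, parikhCode_code G eV eT eI, h⟩
  · intro V T I v t m k eV eT eI G hG
    have h : (∀ w : List T, w ∉ G.language) ↔ ¬ (parikhImage eT G.language).Nonempty := by
      constructor
      · rintro hL ⟨_, w, hw, -⟩
        exact hL w hw
      · intro hL w hw
        exact hL ⟨_, w, hw, rfl⟩
    change ((parikhCode (G.code eV eT eI)).length == 0) = true ↔ _
    rw [h, hG.parikhImage_eq eV eT eI, SemilinearRep.toSet_nonempty_iff, not_not, parikhCode_code]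
    simp [SemilinearRep.code]
  · intro V T I v t m k eV eT eI G hG w
    rw [hG.mem_language_iff_outputReps (eV := eV) (eT := eT) (eI := eI)]
    simp
  · intro V T I v t m k eV eT eI G hG
    change (!(periodEntries (parikhCode (G.code eV eT eI))).length == 0) = true ↔ _
    rw [← infinite_parikhImage_iff eT, hG.parikhImage_eq eV eT eI,
      SemilinearRep.infinite_toSet_iff, ← periodEntries_code_ne_nil, parikhCode_code]
    simp
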